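/- **Conventions.** Let $C^r=\mathbb R/r\mathbb Z$ be the circle of circumference $r$, $d_r$ the length of a shorter arc between two of its points, and $\bar c=c+\frac r2$ the antipode of $c$. A signed graph is a multigraph (loops and parallel edges allowed) with a sign $\pm$ on every edge. A circular $r$-coloring of a signed graph is a map $f$ from its vertices to $C^r$ such that $d_r(f(p),f(q))\ge 1$ for every positive edge $pq$ and $d_r(f(p),\overline{f(q)})\ge 1$ for every negative edge $pq$; $\chi_c$ is the infimum of the $r\ge 1$ for which a circular $r$-coloring exists. Switching at a set of vertices changes the signs of the edges with exactly one end in the set. **Construction.** The *mini-gadget* $(T,\pi)$ has vertices $x,y,z,a,b,c$, positive edges $ab,bc,ca,ax,by,cz$ and negative edges $xy,yz,zx,az,bx,cy$. The *signed Wenger graph* has vertices $u,v,w,z,t,x_1,\dots,x_5$; its positive edges are $wx_1,\dots,wx_5$, $x_1x_2,x_2x_3,x_3x_4,x_4x_5,x_5x_1$, $zx_3,tx_5,vz,vt,vx_3,ux_1,ux_2$, and its negative edges are $zx_2,tx_4,vx_4,ux_5,ut,uz$. Its negative facial triangles are $ux_5x_1$, $zx_2x_3$, $vx_4x_3$, $tx_4x_5$.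 Let $\tilde W$ be obtained by completing each of these four triangles to a switching of the mini-gadget: take a switching of $(T,\pi)$ whose signs on the outer triangle $xyz$ agree with those of the facial triangle, and identify the outer triangle with the facial triangle (in the order of vertices listed), the vertices $a,b,c$ being new for each triangle; any such switchings may be used. Let $\Gamma$ be obtained from $\tilde W$ by adding a negative edge $uv$, let $\mathcal I=(\Gamma,u,v)$, and let $\Omega=K_4(\mathcal I)$ be obtained from $K_4$, with its edges oriented arbitrarily, by replacing each edge $pq$ (oriented from $p$ to $q$) with a new copy of $\Gamma$ in which $u$ is identified with $p$ and $v$ with $q$. **Theorem.** 1. If $0<\epsilon\le\frac23$ and $r=\frac{14}3-\epsilon$, then $d_r(\phi(u),\phi(v))\ge\frac49$ for every circular $r$-coloring $\phi$ of $\tilde W$. 2. $\Omega$ is planar and simple (no loops and no parallel edges), and $\chi_c(\Omega)=\frac{14}3$. 3. Hence the supremum of $\chi_c$ over all finite signed planar simple graphs is at least $4+\frac23$. -/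

import Mathlib

/-!
Signed graphs, circular colorings, planarity, indicators, and the gadgets built from the mini-gadget
and the signed Wenger graph.
-/

/-- A signed (multi)graph with vertex set `V` and edge set `E`; loops and parallel edges are
allowed. The sign of an edge is `1` (positive edge) or `-1` (negative edge). -/
structure SignedGraph (V E : Type*) where
  ends : E → Sym2 V
  sign : E → ℤˣ

namespace SignedGraph

variable {V E : Type*}

/-- The underlying graph is simple: no loops and no parallel edges. -/
def IsSimple (G : SignedGraph V E) : Prop :=
  (∀ e, ¬ (G.ends e).IsDiag) ∧ Function.Injective G.ends

/-- The underlying graph can be drawn in the plane: vertices are distinct points, every edge `e`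
is an arc `t ↦ γ e t`, `0 ≤ t ≤ 1`, joining its two ends, and the open arcs contain no
vertices, have no self-intersections and are pairwise disjoint. -/
def IsPlanar (G : SignedGraph V E) : Prop :=
  ∃ (pos : V → ℝ × ℝ) (γ : E → ℝ → ℝ × ℝ),
    Function.Injective pos ∧
    (∀ e, ContinuousOn (γ e) (Set.Icc 0 1)) ∧
    (∀ e, s(γ e 0, γ e 1) = (G.ends e).map pos) ∧
    (∀ e, ∀ t ∈ Set.Ioo (0 : ℝ) 1, ∀ x, γ e t ≠ pos x) ∧
    (∀ e, Set.InjOn (γ e) (Set.Ioo 0 1)) ∧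
    (∀ e e', e ≠ e' → ∀ t ∈ Set.Ioo (0 : ℝ) 1, ∀ t' ∈ Set.Ioo (0 : ℝ) 1, γ e t ≠ γ e' t')

/-- Circular `r`-colorings. The circle of circumference `r` is `AddCircle r = ℝ / rℤ`,
whose `dist` is (for `r > 0`) the length of a shorter arc; the antipode of `c` is `c + r / 2`. -/
def IsCircularColoring (G : SignedGraph V E) (r : ℝ) (f : V → AddCircle r) : Prop :=
  ∀ e x y, G.ends e = s(x, y) →
    (G.sign e = 1 → 1 ≤ dist (f x) (f y)) ∧
    (G.sign e = -1 → 1 ≤ dist (f x) (f y + ((r / 2 : ℝ) : AddCircle r)))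

/-- The circular chromatic number `χ_c`. -/
noncomputable def circularChromaticNumber (G : SignedGraph V E) : ℝ :=
  sInf {r : ℝ | 1 ≤ r ∧ ∃ f : V → AddCircle r, G.IsCircularColoring r f}

/-- Switching: `τ x = -1` means that we switch at the vertex `x`. -/
def switch (G : SignedGraph V E) (τ : V → ℤˣ) : SignedGraph V E where
  ends := G.ends
  sign e := Sym2.lift ⟨fun x y => τ x * τ y, fun x y => mul_comm (τ x) (τ y)⟩ (G.ends e) * G.sign e

/-- Add a new edge of sign `ε` joining `x` and `y`. -/
def addEdge (G : SignedGraph V E) (x y : V) (ε : ℤˣ) : SignedGraph V (Option E) where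
  ends e := e.elim s(x, y) G.ends
  sign e := e.elim ε G.sign

/-- The signed graph given by a list of edges with signs. -/
def ofList (l : List (V × V × ℤˣ)) : SignedGraph V (Fin l.length) where
  ends i := s((l.get i).1, (l.get i).2.1)
  sign i := (l.get i).2.2

end SignedGraph

/-- The supremum of the circular chromatic number over the class of (finite) signed planar simple
graphs, as an extended real number. -/
noncomputable def chiSignedPlanarSimple : EReal :=
  sSup {c : EReal | ∃ (V E : Type) (_ : Finite V) (_ : Finite E) (G : SignedGraph V E),
    G.IsPlanar ∧ G.IsSimple ∧ c = (G.circularChromaticNumber : EReal)}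

/-- A signed indicator `(Γ, u, v)`. -/
structure SignedIndicator (V E : Type*) where
  graph : SignedGraph V E
  u : V
  v : V
  u_ne_v : u ≠ v

/-- An orientation of a graph: `toProd e` is the pair (tail, head) of the edge `e`. -/
structure EdgeOrientation {V : Type*} (G : SimpleGraph V) where
  toProd : G.edgeSet → V × V
  mk_toProd : ∀ e, s((toProd e).1, (toProd e).2) = (e : Sym2 V)

namespace SignedIndicator

variable {W V E : Type*} [DecidableEq V]

/-- The vertex set of `G(𝓘)`: the vertices of `G`, and for every edge of `G` a copy of the vertices
of the indicator other than `u` and `v`. -/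
abbrev ReplaceVertex (I : SignedIndicator V E) (G : SimpleGraph W) : Type _ :=
  W ⊕ G.edgeSet × {x : V // x ≠ I.u ∧ x ≠ I.v}

/-- Where the vertex `x` of the copy of the indicator belonging to the edge `e` goes: `u` is
identified with the tail of `e`, and `v` with the head of `e`. -/
def place (I : SignedIndicator V E) (G : SimpleGraph W) (o : EdgeOrientation G)
    (e : G.edgeSet) (x : V) : I.ReplaceVertex G :=
  if hu : x = I.u then Sum.inl (o.toProd e).1
  else if hv : x = I.v then Sum.inl (o.toProd e).2
  else Sum.inr (e, ⟨x, hu, hv⟩)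

/-- The signed graph `G(𝓘)`: every edge of `G`, oriented by `o`, is replaced with a copy of the
indicator. -/
def replace (I : SignedIndicator V E) (G : SimpleGraph W) (o : EdgeOrientation G) :
    SignedGraph (I.ReplaceVertex G) (G.edgeSet × E) where
  ends e := (I.graph.ends e.2).map (I.place G o e.1)
  sign e := I.graph.sign e.2

end SignedIndicator

/-- Vertices of the mini-gadget: the outer triangle `x y z` and the inner triangle `a b c`. -/
inductive MiniVertex
  | x | y | z | a | b | c
  deriving DecidableEq

namespace MiniVertex

/-- The outer edges of the mini-gadget. -/
def outerEdges : List (MiniVertex × MiniVertex × ℤˣ) :=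
  [(x, y, -1), (y, z, -1), (z, x, -1)]

/-- The edges of the mini-gadget having an end in the inner triangle. -/
def innerEdges : List (MiniVertex × MiniVertex × ℤˣ) :=
  [(a, b, 1), (b, c, 1), (a, c, 1), (a, x, 1), (b, y, 1), (c, z, 1),
    (a, z, -1), (b, x, -1), (c, y, -1)]

end MiniVertex

/-- The mini-gadget `(T, π)`. -/
def miniGadget : SignedGraph MiniVertex (Fin (MiniVertex.outerEdges ++ MiniVertex.innerEdges).length) :=
  SignedGraph.ofList (MiniVertex.outerEdges ++ MiniVertex.innerEdges)

/-- Vertices of the Wenger graph. -/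
inductive WengerVertex
  | u | v | w | z | t | x₁ | x₂ | x₃ | x₄ | x₅
  deriving DecidableEq

namespace WengerVertex

/-- The edges of the signed Wenger graph. -/
def edges : List (WengerVertex × WengerVertex × ℤˣ) :=
  [(w, x₁, 1), (w, x₂, 1), (w, x₃, 1), (w, x₄, 1), (w, x₅, 1),
    (x₁, x₂, 1), (x₂, x₃, 1), (x₃, x₄, 1), (x₄, x₅, 1), (x₅, x₁, 1),
    (z, x₂, -1), (z, x₃, 1), (t, x₄, -1), (t, x₅, 1),
    (v, z, 1), (v, t, 1), (v, x₃, 1), (v, x₄, -1),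
    (u, x₁, 1), (u, x₂, 1), (u, x₅, -1), (u, t, -1), (u, z, -1)]

/-- The corners of the four negative facial triangles. -/
def corners : Fin 4 → WengerVertex × WengerVertex × WengerVertex :=
  ![(u, x₅, x₁), (z, x₂, x₃), (v, x₄, x₃), (t, x₄, x₅)]

end WengerVertex

/-- The signed Wenger graph. -/
def signedWenger : SignedGraph WengerVertex (Fin WengerVertex.edges.length) :=
  SignedGraph.ofList WengerVertex.edges

/-- Where the vertices of the mini-gadget filling the `i`-th negative facial triangle go: the outer
triangle `x y z` is identified with the facial triangle, and `a`, `b`, `c` are new vertices. -/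
def fillPlace (i : Fin 4) : MiniVertex → WengerVertex ⊕ Fin 4 × Fin 3
  | .x => Sum.inl (WengerVertex.corners i).1
  | .y => Sum.inl (WengerVertex.corners i).2.1
  | .z => Sum.inl (WengerVertex.corners i).2.2
  | .a => Sum.inr (i, 0)
  | .b => Sum.inr (i, 1)
  | .c => Sum.inr (i, 2)

/-- `τ i` is the switching applied to the mini-gadget that fills the `i`-th triangle. It is
admissible if the switched mini-gadget agrees in sign with the signed Wenger graph on the three
edges of the triangle. -/
def IsAdmissibleSwitching (τ : Fin 4 → MiniVertex → ℤˣ) : Prop :=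
  ∀ (i : Fin 4) (f : Fin (MiniVertex.outerEdges ++ MiniVertex.innerEdges).length)
    (e : Fin WengerVertex.edges.length),
    (miniGadget.ends f).map (fillPlace i) = (signedWenger.ends e).map Sum.inl →
      (miniGadget.switch (τ i)).sign f = signedWenger.sign e

/-- Switching every mini-gadget at its vertex `z` is admissible. -/
theorem isAdmissibleSwitching_z :
    IsAdmissibleSwitching fun _ p => if p = MiniVertex.z then -1 else 1 := by
  unfold IsAdmissibleSwitching
  decide +kernel

/-- The mini-gadget with its outer edges removed. -/
def miniGadgetInner : SignedGraph MiniVertex (Fin MiniVertex.innerEdges.length) :=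
  SignedGraph.ofList MiniVertex.innerEdges

/-- The signed graph `W̃`: each of the four negative facial triangles of the signed Wenger graph is
completed to a copy of the mini-gadget switched by `τ i`. -/
def filledWenger (τ : Fin 4 → MiniVertex → ℤˣ) :
    SignedGraph (WengerVertex ⊕ Fin 4 × Fin 3)
      (Fin WengerVertex.edges.length ⊕ Fin 4 × Fin MiniVertex.innerEdges.length) where
  ends := Sum.elim (fun e => (signedWenger.ends e).map Sum.inl)
    (fun f => (miniGadgetInner.ends f.2).map (fillPlace f.1))
  sign := Sum.elim signedWenger.sign (fun f => (miniGadgetInner.switch (τ f.1)).sign f.2)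

/-- The indicator `𝓘 = (Γ, u, v)`, where `Γ` is `W̃` with a negative edge `uv` added. -/
def wengerIndicator (τ : Fin 4 → MiniVertex → ℤˣ) :
    SignedIndicator (WengerVertex ⊕ Fin 4 × Fin 3)
      (Option (Fin WengerVertex.edges.length ⊕ Fin 4 × Fin MiniVertex.innerEdges.length)) where
  graph := (filledWenger τ).addEdge (Sum.inl .u) (Sum.inl .v) (-1)
  u := Sum.inl .u
  v := Sum.inl .v
  u_ne_v := by decide

/-- The signed graph `Ω = K₄(𝓘)`, for an orientation `o` of the edges of `K₄`. -/
def omegaGraph (τ : Fin 4 → MiniVertex → ℤˣ)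
    (o : EdgeOrientation (⊤ : SimpleGraph (Fin 4))) :=
  (wengerIndicator τ).replace (⊤ : SimpleGraph (Fin 4)) o

/-!
The signed graph `Ω` has no circular `r`-coloring for `r < 14 / 3` because the indicator keeps the
colors of its ends apart, but not too far apart. The negative edge `u v` forces their distance to be
at most `r / 2 - 1 < 4 / 3`, and `W̃` forces it to be at least `4 / 9`
(`le_dist_of_isCircularColoring_filledWenger`). In `K₄` this would give four points with pairwise
distances in this range; they would lie on an arc shorter than `4 / 3`, which is too short for three
gaps of length `4 / 9` (`not_forall_dist_of_four`). With `r = 14 / 3` there is just enough room, and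
the colors `0`, `4 / 9`, `8 / 9`, `12 / 9` of the vertices of `K₄` extend to all copies of the
indicator (`exists_isCircularColoring_omegaGraph`).

For the bound `4 / 9`, the coloring is lifted to the interval `[0, r]` with the color of `w` at `0`.
A mini-gadget extends a coloring of its outer triangle only if, for its original signs, two of the
outer vertices have distance at least `3 - r / 2` (`miniGadget_dist`), which turns every filled
triangle into a disjunction of linear inequalities. The lifts of `x₁, …, x₅` alternate between the
two ends of `[1, r - 1]` with a single exception, a vertex between its two neighbors
(`IsWengerLift.apart_of_one_le_sub`). For each position of this vertex, the remaining conditions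
are systems of linear inequalities in the lifts and `r`, which are inconsistent if `u` and `v` are
closer than `4 / 9`. A reflection of the circle halves the number of cases, and as admissible
switchings differ only by switching at inner vertices of the mini-gadgets, one of them suffices
(`switch_filledWenger`).

For planarity, the indicator has a straight-line drawing with small integer coordinates, squeezed
into a thin rhombus with opposite corners `u` and `v`. Similar copies of the rhombus around the
edges of a straight-line drawing of `K₄` do not overlap (`isStraightLineDrawing_omegaGraph`). A
graph with a straight-line drawing is simple.
-/

/-! ### Straight-line drawings -/

/-- Twice the signed area of the triangle `p q x`: it is positive if `x` lies on the left of the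
line from `p` to `q`. -/
def cross {R : Type*} [CommRing R] (p q x : R × R) : R :=
  (q.1 - p.1) * (x.2 - p.2) - (q.2 - p.2) * (x.1 - p.1)

/-- The points `a` and `b` lie in the same closed half-plane bounded by the line `p q`, and not both
on that line. -/
def OnOneSide {R : Type*} [CommRing R] [LinearOrder R] (p q a b : R × R) : Prop :=
  0 ≤ cross p q a ∧ 0 ≤ cross p q b ∧ 0 < cross p q a + cross p q b ∨
    cross p q a ≤ 0 ∧ cross p q b ≤ 0 ∧ cross p q a + cross p q b < 0

instance (p q a b : ℤ × ℤ) : Decidable (OnOneSide p q a b) := by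
  unfold OnOneSide; infer_instance

theorem cross_lineMap (p q a b : ℝ × ℝ) (t : ℝ) :
    cross p q (AffineMap.lineMap a b t) = (1 - t) * cross p q a + t * cross p q b := by
  simp [cross, AffineMap.lineMap_apply]
  ring

theorem cross_self_left (p q : ℝ × ℝ) : cross p q p = 0 := by
  simp [cross]

theorem cross_self_right (p q : ℝ × ℝ) : cross p q q = 0 := by
  simp [cross]; ring

theorem cross_lineMap_self (p q : ℝ × ℝ) (t : ℝ) :
    cross p q (AffineMap.lineMap p q t) = 0 := by
  rw [cross_lineMap, cross_self_left, cross_self_right]; ring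

/-- An open segment with ends on one side of a line does not meet the line. -/
theorem OnOneSide.lineMap_ne {p q a b : ℝ × ℝ} (h : OnOneSide p q a b) {t t' : ℝ}
    (ht' : t' ∈ Set.Ioo (0 : ℝ) 1) : AffineMap.lineMap p q t ≠ AffineMap.lineMap a b t' := by
  intro he
  have h0 : (1 - t') * cross p q a + t' * cross p q b = 0 := by
    rw [← cross_lineMap, ← he, cross_lineMap_self]
  obtain ⟨h1, h2⟩ := ht'
  have h1' : 0 < 1 - t' := by linarith
  rcases h with ⟨ha, hb, hab⟩ | ⟨ha, hb, hab⟩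
  · have := mul_nonneg h1'.le ha
    have := mul_nonneg h1.le hb
    have ha0 : cross p q a = 0 :=
      (mul_eq_zero.1 (by linarith : (1 - t') * cross p q a = 0)).resolve_left h1'.ne'
    have hb0 : cross p q b = 0 :=
      (mul_eq_zero.1 (by linarith : t' * cross p q b = 0)).resolve_left h1.ne'
    linarith
  · have := mul_nonpos_of_nonneg_of_nonpos h1'.le ha
    have := mul_nonpos_of_nonneg_of_nonpos h1.le hb
    have ha0 : cross p q a = 0 :=
      (mul_eq_zero.1 (by linarith : (1 - t') * cross p q a = 0)).resolve_left h1'.ne'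
    have hb0 : cross p q b = 0 :=
      (mul_eq_zero.1 (by linarith : t' * cross p q b = 0)).resolve_left h1.ne'
    linarith

theorem lineMap_ne_of_cross_ne_zero {p q x : ℝ × ℝ} (h : cross p q x ≠ 0) (t : ℝ) :
    AffineMap.lineMap p q t ≠ x := by
  rintro rfl
  exact h (cross_lineMap_self p q t)

theorem lineMap_ne_left {p q : ℝ × ℝ} (h : p ≠ q) {t : ℝ} (ht : t ≠ 0) :
    AffineMap.lineMap p q t ≠ p := by
  intro he
  rw [AffineMap.lineMap_eq_left_iff] at he
  exact he.elim h ht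

theorem lineMap_ne_right {p q : ℝ × ℝ} (h : p ≠ q) {t : ℝ} (ht : t ≠ 1) :
    AffineMap.lineMap p q t ≠ q := by
  intro he
  rw [AffineMap.lineMap_eq_right_iff] at he
  exact he.elim h ht

namespace SignedGraph

variable {V E : Type*}

/-- A straight-line drawing: the vertex `x` is drawn at `pos x`, and the edge `e` as the segment
from `pos (tail e)` to `pos (head e)`; no vertex lies in an open segment, and the open segments of
different edges are disjoint. -/
structure IsStraightLineDrawing (G : SignedGraph V E) (pos : V → ℝ × ℝ) (tail head : E → V) :
    Prop where
  ends_eq : ∀ e, G.ends e = s(tail e, head e)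
  injective : Function.Injective pos
  ne_pos : ∀ e, ∀ t ∈ Set.Ioo (0 : ℝ) 1, ∀ x,
    AffineMap.lineMap (pos (tail e)) (pos (head e)) t ≠ pos x
  disjoint : ∀ e e', e ≠ e' → ∀ t ∈ Set.Ioo (0 : ℝ) 1, ∀ t' ∈ Set.Ioo (0 : ℝ) 1,
    (AffineMap.lineMap (pos (tail e)) (pos (head e)) t : ℝ × ℝ) ≠
      AffineMap.lineMap (pos (tail e')) (pos (head e')) t'

variable {G : SignedGraph V E} {pos : V → ℝ × ℝ} {tail head : E → V}

theorem IsStraightLineDrawing.tail_ne_head (h : G.IsStraightLineDrawing pos tail head) (e : E) :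
    tail e ≠ head e := by
  intro he
  refine h.ne_pos e (1 / 2) (by norm_num) (tail e) ?_
  rw [← he, AffineMap.lineMap_same_apply]

theorem IsStraightLineDrawing.isPlanar (h : G.IsStraightLineDrawing pos tail head) :
    G.IsPlanar := by
  refine ⟨pos, fun e t => AffineMap.lineMap (pos (tail e)) (pos (head e)) t, h.injective,
    fun e => AffineMap.lineMap_continuous.continuousOn, fun e => ?_, h.ne_pos, fun e => ?_,
    h.disjoint⟩
  · simp [h.ends_eq]
  · exact (AffineMap.lineMap_injective ℝ (h.injective.ne (h.tail_ne_head e))).injOn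

/-- Two parallel edges would be drawn as the same segment, and a loop as a single point. -/
theorem IsStraightLineDrawing.isSimple (h : G.IsStraightLineDrawing pos tail head) :
    G.IsSimple := by
  refine ⟨fun e => ?_, fun e e' he => ?_⟩
  · rw [h.ends_eq]
    exact h.tail_ne_head e
  · by_contra hne
    refine h.disjoint e e' hne (1 / 2) (by norm_num) (1 / 2) (by norm_num) ?_
    rw [h.ends_eq, h.ends_eq, Sym2.eq_iff] at he
    obtain ⟨h1, h2⟩ | ⟨h1, h2⟩ := he
    · rw [h1, h2]
    · rw [h1, h2, ← AffineMap.lineMap_apply_one_sub]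
      norm_num

end SignedGraph

/-- An affine map of the plane which stretches the coordinate axes changes all signed areas by the
same factor. -/
theorem cross_scale (α β : ℝ) (p q x : ℤ × ℤ) :
    cross (α * p.1, β * p.2) (α * q.1, β * q.2) (α * x.1, β * x.2) =
      α * β * (cross p q x : ℤ) := by
  simp [cross]
  ring

theorem OnOneSide.scale {α β : ℝ} (hα : 0 < α) (hβ : 0 < β) {p q a b : ℤ × ℤ}
    (h : OnOneSide p q a b) :
    OnOneSide (α * p.1, β * p.2) (α * q.1, β * q.2) (α * a.1, β * a.2) (α * b.1, β * b.2) := by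
  have hαβ := mul_pos hα hβ
  simp only [OnOneSide, cross_scale, ← mul_add, ← Int.cast_add]
  refine h.imp (fun ⟨h1, h2, h3⟩ => ⟨?_, ?_, ?_⟩) (fun ⟨h1, h2, h3⟩ => ⟨?_, ?_, ?_⟩)
  · exact mul_nonneg hαβ.le (by exact_mod_cast h1)
  · exact mul_nonneg hαβ.le (by exact_mod_cast h2)
  · exact mul_pos hαβ (by exact_mod_cast h3)
  · exact mul_nonpos_of_nonneg_of_nonpos hαβ.le (by exact_mod_cast h1)
  · exact mul_nonpos_of_nonneg_of_nonpos hαβ.le (by exact_mod_cast h2)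
  · exact mul_neg_of_pos_of_neg hαβ (by exact_mod_cast h3)

/-- A drawing with integer coordinates in general position, stretched along the axes. -/
theorem SignedGraph.isStraightLineDrawing_of_int {V E : Type*} {G : SignedGraph V E}
    {pos : V → ℤ × ℤ} {tail head : E → V} {α β : ℝ} (hα : 0 < α) (hβ : 0 < β)
    (ends_eq : ∀ e, G.ends e = s(tail e, head e))
    (injective : ∀ x y, pos x = pos y → x = y)
    (tail_ne_head : ∀ e, tail e ≠ head e)
    (cross_ne : ∀ e x, x ≠ tail e → x ≠ head e → cross (pos (tail e)) (pos (head e)) (pos x) ≠ 0)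
    (oneSide : ∀ e e', e ≠ e' →
      OnOneSide (pos (tail e)) (pos (head e)) (pos (tail e')) (pos (head e')) ∨
      OnOneSide (pos (tail e')) (pos (head e')) (pos (tail e)) (pos (head e))) :
    G.IsStraightLineDrawing (fun x => (α * (pos x).1, β * (pos x).2)) tail head := by
  have hinj : Function.Injective (fun x => ((α * (pos x).1, β * (pos x).2) : ℝ × ℝ)) := by
    intro x y hxy
    simp only [Prod.mk.injEq, mul_eq_mul_left_iff, hα.ne', hβ.ne', or_false, Int.cast_inj] at hxy
    exact injective x y (Prod.ext hxy.1 hxy.2)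
  refine ⟨ends_eq, hinj, fun e t ht x => ?_, fun e e' hne t ht t' ht' => ?_⟩
  · by_cases h1 : x = tail e
    · rw [h1]
      exact lineMap_ne_left (hinj.ne (tail_ne_head e)) ht.1.ne'
    by_cases h2 : x = head e
    · rw [h2]
      exact lineMap_ne_right (hinj.ne (tail_ne_head e)) ht.2.ne
    refine lineMap_ne_of_cross_ne_zero ?_ t
    rw [cross_scale]
    exact mul_ne_zero (mul_pos hα hβ).ne' (by exact_mod_cast cross_ne e x h1 h2)
  · rcases oneSide e e' hne with h | h
    · exact (h.scale hα hβ).lineMap_ne ht'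
    · exact ((h.scale hα hβ).lineMap_ne ht).symm

/-! ### Drawing a graph whose edges are replaced with an indicator -/

/-- The open segment from `(0, 0)` to `(1, 0)`, thickened to a rhombus of slope `κ`. -/
def thinRhombus (κ : ℝ) : Set (ℝ × ℝ) :=
  {z | 0 < z.1 ∧ z.1 < 1 ∧ |z.2| ≤ κ * z.1 ∧ |z.2| ≤ κ * (1 - z.1)}

/-- The orientation-preserving similarity taking `(0, 0)` to `P` and `(1, 0)` to `Q`. -/
def similarity (P Q z : ℝ × ℝ) : ℝ × ℝ :=
  (P.1 + z.1 * (Q.1 - P.1) - z.2 * (Q.2 - P.2), P.2 + z.1 * (Q.2 - P.2) + z.2 * (Q.1 - P.1))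

theorem similarity_zero (P Q : ℝ × ℝ) : similarity P Q (0, 0) = P := by
  simp [similarity]

theorem similarity_one (P Q : ℝ × ℝ) : similarity P Q (1, 0) = Q := by
  simp [similarity]

theorem similarity_lineMap (P Q a b : ℝ × ℝ) (t : ℝ) :
    AffineMap.lineMap (similarity P Q a) (similarity P Q b) t =
      similarity P Q (AffineMap.lineMap a b t) := by
  ext <;> simp [similarity, AffineMap.lineMap_apply] <;> ring

theorem similarity_injective {P Q : ℝ × ℝ} (h : P ≠ Q) :
    Function.Injective (similarity P Q) := by
  intro z z' hz
  simp only [similarity, Prod.mk.injEq] at hz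
  obtain ⟨h1, h2⟩ := hz
  set a := Q.1 - P.1 with ha
  set b := Q.2 - P.2 with hb
  have hab : a ^ 2 + b ^ 2 ≠ 0 := by
    intro h0
    have ha0 : a = 0 := by nlinarith [sq_nonneg a, sq_nonneg b]
    have hb0 : b = 0 := by nlinarith [sq_nonneg a, sq_nonneg b]
    exact h (Prod.ext (by linarith) (by linarith))
  refine Prod.ext (mul_left_cancel₀ hab ?_) (mul_left_cancel₀ hab ?_)
  · linear_combination a * h1 + b * h2
  · linear_combination a * h2 - b * h1

/-- Reversing an edge turns the rhombus drawn around it by a half-turn. -/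
theorem exists_similarity_swap {κ : ℝ} (P Q : ℝ × ℝ) {z : ℝ × ℝ} (hz : z ∈ thinRhombus κ) :
    ∃ z' ∈ thinRhombus κ, similarity P Q z = similarity Q P z' := by
  obtain ⟨h1, h2, h3, h4⟩ := hz
  refine ⟨(1 - z.1, -z.2), ⟨by simpa using h2, by simpa using h1, ?_, ?_⟩, ?_⟩
  · simpa using h4
  · simpa using h3
  · ext <;> simp only [similarity] <;> ring

theorem mem_thinRhombus_of_ne {κ : ℝ} {z : ℝ × ℝ} (h3 : |z.2| ≤ κ * z.1)
    (h4 : |z.2| ≤ κ * (1 - z.1)) (hκ : 0 < κ) (h0 : z ≠ (0, 0)) (h1 : z ≠ (1, 0)) :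
    z ∈ thinRhombus κ := by
  have hz0 : 0 ≤ z.1 := nonneg_of_mul_nonneg_right ((abs_nonneg _).trans h3) hκ
  have hz1 : 0 ≤ 1 - z.1 := nonneg_of_mul_nonneg_right ((abs_nonneg _).trans h4) hκ
  refine ⟨hz0.lt_of_ne fun h => h0 ?_, sub_pos.1 (hz1.lt_of_ne fun h => h1 ?_), h3, h4⟩
  · rw [← h, mul_zero] at h3
    exact Prod.ext h.symm (abs_nonpos_iff.1 h3)
  · rw [← h, mul_zero] at h4
    exact Prod.ext (by simpa using (sub_eq_zero.1 h.symm).symm) (abs_nonpos_iff.1 h4)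

theorem abs_lineMap_snd_le {κ : ℝ} {a b : ℝ × ℝ} {t : ℝ} (ht : t ∈ Set.Ioo (0 : ℝ) 1)
    (ha : |a.2| ≤ κ * a.1 ∧ |a.2| ≤ κ * (1 - a.1))
    (hb : |b.2| ≤ κ * b.1 ∧ |b.2| ≤ κ * (1 - b.1)) :
    |(AffineMap.lineMap a b t : ℝ × ℝ).2| ≤ κ * (AffineMap.lineMap a b t : ℝ × ℝ).1 ∧
      |(AffineMap.lineMap a b t : ℝ × ℝ).2| ≤
        κ * (1 - (AffineMap.lineMap a b t : ℝ × ℝ).1) := by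
  have h1 : (AffineMap.lineMap a b t : ℝ × ℝ).1 = (1 - t) * a.1 + t * b.1 := by
    simp [AffineMap.lineMap_apply]; ring
  have h2 : (AffineMap.lineMap a b t : ℝ × ℝ).2 = (1 - t) * a.2 + t * b.2 := by
    simp [AffineMap.lineMap_apply]; ring
  have hle : |(1 - t) * a.2 + t * b.2| ≤ (1 - t) * |a.2| + t * |b.2| := by
    refine (abs_add_le _ _).trans_eq ?_
    rw [abs_mul, abs_mul, abs_of_pos ht.1, abs_of_pos (sub_pos.2 ht.2)]
  have ht1 : 0 ≤ 1 - t := sub_nonneg.2 ht.2.le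
  rw [h1, h2]
  constructor
  · linarith [mul_le_mul_of_nonneg_left ha.1 ht1, mul_le_mul_of_nonneg_left hb.1 ht.1.le]
  · linarith [mul_le_mul_of_nonneg_left ha.2 ht1, mul_le_mul_of_nonneg_left hb.2 ht.1.le]

namespace SignedIndicator

variable {W V E : Type*} [DecidableEq V] {I : SignedIndicator V E} {G : SimpleGraph W}
  {o : EdgeOrientation G}

/-- The position of a vertex of `G(𝓘)`, if the vertices of `G` are drawn at `posW` and every copy of
the indicator is drawn along its edge by a similarity. -/
def replacePos (posW : W → ℝ × ℝ) (o : EdgeOrientation G) (pos : V → ℝ × ℝ) :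
    I.ReplaceVertex G → ℝ × ℝ :=
  Sum.elim posW fun ex => similarity (posW (o.toProd ex.1).1) (posW (o.toProd ex.1).2) (pos ex.2)

theorem replacePos_place {posW : W → ℝ × ℝ} {pos : V → ℝ × ℝ} (hu : pos I.u = (0, 0))
    (hv : pos I.v = (1, 0)) (e : G.edgeSet) (x : V) :
    replacePos posW o pos (I.place G o e x) =
      similarity (posW (o.toProd e).1) (posW (o.toProd e).2) (pos x) := by
  unfold place
  split_ifs with h1 h2
  · simp [replacePos, h1, hu, similarity_zero]
  · simp [replacePos, h2, hv, similarity_one]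
  · simp [replacePos]

/-- A drawing of the indicator inside a thin rhombus with corners `u` and `v` can be copied along
the edges of a drawing of `G`, provided that the rhombi around the edges of `G` are pairwise
disjoint and contain no vertices of `G`. -/
theorem isStraightLineDrawing_replace {pos : V → ℝ × ℝ} {tail head : E → V}
    (h : I.graph.IsStraightLineDrawing pos tail head) {posW : W → ℝ × ℝ} {κ : ℝ} (hκ : 0 < κ)
    (hu : pos I.u = (0, 0)) (hv : pos I.v = (1, 0))
    (hpos : ∀ x, |(pos x).2| ≤ κ * (pos x).1 ∧ |(pos x).2| ≤ κ * (1 - (pos x).1))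
    (hW : Function.Injective posW)
    (hvertex : ∀ p q k, G.Adj p q → ∀ z ∈ thinRhombus κ,
      similarity (posW p) (posW q) z ≠ posW k)
    (hedge : ∀ p q p' q', G.Adj p q → G.Adj p' q' → s(p, q) ≠ s(p', q') →
      ∀ z ∈ thinRhombus κ, ∀ z' ∈ thinRhombus κ,
        similarity (posW p) (posW q) z ≠ similarity (posW p') (posW q') z') :
    (I.replace G o).IsStraightLineDrawing (replacePos posW o pos)
      (fun e => I.place G o e.1 (tail e.2)) (fun e => I.place G o e.1 (head e.2)) := by
  have hadj (e : G.edgeSet) : G.Adj (o.toProd e).1 (o.toProd e).2 := by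
    rw [← SimpleGraph.mem_edgeSet, o.mk_toProd]
    exact e.2
  have hsim (e : G.edgeSet) : Function.Injective
      (similarity (posW (o.toProd e).1) (posW (o.toProd e).2)) :=
    similarity_injective (hW.ne (hadj e).ne)
  have hedge' (e e' : G.edgeSet) (hne : e ≠ e') (z : ℝ × ℝ) (hz : z ∈ thinRhombus κ) (z' : ℝ × ℝ)
      (hz' : z' ∈ thinRhombus κ) : similarity (posW (o.toProd e).1) (posW (o.toProd e).2) z ≠
        similarity (posW (o.toProd e').1) (posW (o.toProd e').2) z' := by
    refine hedge _ _ _ _ (hadj e) (hadj e') ?_ z hz z' hz'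
    rw [o.mk_toProd, o.mk_toProd]
    exact fun h => hne (Subtype.ext h)
  have hin (x : {x : V // x ≠ I.u ∧ x ≠ I.v}) : pos x ∈ thinRhombus κ :=
    mem_thinRhombus_of_ne (hpos x).1 (hpos x).2 hκ (hu ▸ h.injective.ne x.2.1)
      (hv ▸ h.injective.ne x.2.2)
  have hseg (f : E) (t : ℝ) (ht : t ∈ Set.Ioo (0 : ℝ) 1) :
      (AffineMap.lineMap (pos (tail f)) (pos (head f)) t : ℝ × ℝ) ∈ thinRhombus κ := by
    have := abs_lineMap_snd_le ht (hpos (tail f)) (hpos (head f))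
    exact mem_thinRhombus_of_ne this.1 this.2 hκ (hu ▸ h.ne_pos f t ht I.u)
      (hv ▸ h.ne_pos f t ht I.v)
  refine ⟨fun e => ?_, ?_, ?_, ?_⟩
  · simp [replace, h.ends_eq]
  · rintro (k | ⟨e, x⟩) (k' | ⟨e', x'⟩) hxy
    · exact congrArg _ (hW hxy)
    · exact absurd hxy.symm (hvertex _ _ _ (hadj e') _ (hin x'))
    · exact absurd hxy (hvertex _ _ _ (hadj e) _ (hin x))
    · by_cases hee : e = e'
      · subst hee
        rw [show x = x' from Subtype.ext (h.injective (hsim e hxy))]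
      · exact absurd hxy (hedge' e e' hee _ (hin x) _ (hin x'))
  · rintro ⟨e, f⟩ t ht (k | ⟨e', x⟩)
    · simp only [replacePos_place hu hv, similarity_lineMap]
      exact hvertex _ _ _ (hadj e) _ (hseg f t ht)
    · simp only [replacePos_place hu hv, similarity_lineMap]
      by_cases hee : e = e'
      · subst hee
        exact (hsim e).ne (h.ne_pos f t ht x)
      · exact hedge' e e' hee _ (hseg f t ht) _ (hin x)
  · rintro ⟨e, f⟩ ⟨e', f'⟩ hne t ht t' ht'
    simp only [replacePos_place hu hv, similarity_lineMap]
    by_cases hee : e = e'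
    · subst hee
      exact (hsim e).ne (h.disjoint f f' (fun hf => hne (by rw [hf])) t ht t' ht')
    · exact hedge' e e' hee _ (hseg f t ht) _ (hseg f' t' ht')

end SignedIndicator

/-- The vertices of `K₄`: the corners and an inner point of a triangle. -/
def k4Pos : Fin 4 → ℝ × ℝ := ![(0, 0), (0, 3), (-3, -2), (3, -2)]

theorem k4Pos_injective : Function.Injective k4Pos := by
  intro p q h
  fin_cases p <;> fin_cases q <;> simp [k4Pos] at h ⊢ <;> norm_num at h

theorem similarity_k4Pos_ne_k4Pos_of_lt {p q : Fin 4} (k : Fin 4) (hpq : p < q) {z : ℝ × ℝ}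
    (hz : z ∈ thinRhombus (1 / 10)) : similarity (k4Pos p) (k4Pos q) z ≠ k4Pos k := by
  obtain ⟨h1, h2, h3, h4⟩ := hz
  rw [abs_le] at h3 h4
  intro h
  fin_cases p <;> fin_cases q <;> simp at hpq <;> fin_cases k <;>
    simp [similarity, k4Pos] at h <;> linarith [h.1, h.2]

theorem similarity_k4Pos_ne_of_lt {p q p' q' : Fin 4} (hpq : p < q) (hpq' : p' < q')
    (hne : p ≠ p' ∨ q ≠ q') {z z' : ℝ × ℝ} (hz : z ∈ thinRhombus (1 / 10))
    (hz' : z' ∈ thinRhombus (1 / 10)) :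
    similarity (k4Pos p) (k4Pos q) z ≠ similarity (k4Pos p') (k4Pos q') z' := by
  obtain ⟨h1, h2, h3, h4⟩ := hz
  obtain ⟨h1', h2', h3', h4'⟩ := hz'
  rw [abs_le] at h3 h4 h3' h4'
  intro h
  simp only [similarity, Prod.mk.injEq] at h
  fin_cases p <;> fin_cases q <;> simp at hpq <;> fin_cases p' <;> fin_cases q' <;>
    simp at hpq' hne <;> simp [k4Pos] at h <;> linarith [h.1, h.2]

theorem similarity_k4Pos_ne_k4Pos (p q k : Fin 4) (hpq : p ≠ q) (z : ℝ × ℝ)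
    (hz : z ∈ thinRhombus (1 / 10)) : similarity (k4Pos p) (k4Pos q) z ≠ k4Pos k := by
  rcases hpq.lt_or_gt with h | h
  · exact similarity_k4Pos_ne_k4Pos_of_lt k h hz
  · obtain ⟨z', hz', he⟩ := exists_similarity_swap (k4Pos p) (k4Pos q) hz
    rw [he]
    exact similarity_k4Pos_ne_k4Pos_of_lt k h hz'

theorem similarity_k4Pos_ne (p q p' q' : Fin 4) (hpq : p ≠ q) (hpq' : p' ≠ q')
    (hne : s(p, q) ≠ s(p', q')) (z : ℝ × ℝ) (hz : z ∈ thinRhombus (1 / 10)) (z' : ℝ × ℝ)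
    (hz' : z' ∈ thinRhombus (1 / 10)) :
    similarity (k4Pos p) (k4Pos q) z ≠ similarity (k4Pos p') (k4Pos q') z' := by
  wlog h : p < q generalizing p q z
  · obtain ⟨y, hy, he⟩ := exists_similarity_swap (k4Pos p) (k4Pos q) hz
    rw [he]
    exact this q p hpq.symm (by rwa [Sym2.eq_swap]) y hy (lt_of_le_of_ne (not_lt.1 h) hpq.symm)
  wlog h' : p' < q' generalizing p' q' z'
  · obtain ⟨y, hy, he⟩ := exists_similarity_swap (k4Pos p') (k4Pos q') hz'
    rw [he]
    exact this q' p' hpq'.symm y hy (by rwa [Sym2.eq_swap (a := q')])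
      (lt_of_le_of_ne (not_lt.1 h') hpq'.symm)
  refine similarity_k4Pos_ne_of_lt h h' ?_ hz hz'
  by_contra hc
  push Not at hc
  exact hne (by rw [hc.1, hc.2])

/-! ### A drawing of the indicator -/

/-- Positions of the vertices of the Wenger graph in a planar drawing in which the outer face
of the indicator is the triangle `u v t`. -/
def wengerPos : WengerVertex → ℤ × ℤ
  | .u => (0, 0)
  | .v => (8, 0)
  | .w => (3, -7)
  | .z => (3, -2)
  | .t => (4, -32)
  | .x₁ => (1, -5)
  | .x₂ => (2, -4)
  | .x₃ => (4, -4)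
  | .x₄ => (5, -11)
  | .x₅ => (2, -12)

/-- Seven times the point with barycentric coordinates `l / 7` in the `i`-th facial triangle. -/
def cornerCombination (i : Fin 4) (l : ℤ × ℤ × ℤ) : ℤ × ℤ :=
  l.1 • wengerPos (WengerVertex.corners i).1 + l.2.1 • wengerPos (WengerVertex.corners i).2.1 +
    l.2.2 • wengerPos (WengerVertex.corners i).2.2

/-- The drawing of `W̃`, scaled by `7`: each of the inner vertices `a`, `b`, `c` of a mini-gadget is
placed close to the side of the triangle with whose ends it is adjacent. -/
def filledWengerPos : WengerVertex ⊕ Fin 4 × Fin 3 → ℤ × ℤ :=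
  Sum.elim (fun x => 7 • wengerPos x) fun ij =>
    cornerCombination ij.1 (![(3, 1, 3), (3, 3, 1), (1, 3, 3)] ij.2)

/-- The two ends of an edge of the indicator. -/
def indicatorEnds : Option (Fin WengerVertex.edges.length ⊕
    Fin 4 × Fin MiniVertex.innerEdges.length) →
      (WengerVertex ⊕ Fin 4 × Fin 3) × (WengerVertex ⊕ Fin 4 × Fin 3)
  | none => (Sum.inl .u, Sum.inl .v)
  | some (Sum.inl e) =>
    (Sum.inl (WengerVertex.edges.get e).1, Sum.inl (WengerVertex.edges.get e).2.1)
  | some (Sum.inr (i, f)) =>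
    (fillPlace i (MiniVertex.innerEdges.get f).1, fillPlace i (MiniVertex.innerEdges.get f).2.1)

theorem wengerIndicator_ends (τ : Fin 4 → MiniVertex → ℤˣ) (e) :
    (wengerIndicator τ).graph.ends e = s((indicatorEnds e).1, (indicatorEnds e).2) := by
  rcases e with _ | e | ⟨i, f⟩ <;> rfl

instance : Fintype WengerVertex where
  elems := {.u, .v, .w, .z, .t, .x₁, .x₂, .x₃, .x₄, .x₅}
  complete x := by cases x <;> decide

set_option maxRecDepth 10000 in
theorem oneSide_indicatorEnds : ∀ e e', e ≠ e' →
    OnOneSide (filledWengerPos (indicatorEnds e).1) (filledWengerPos (indicatorEnds e).2)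
      (filledWengerPos (indicatorEnds e').1) (filledWengerPos (indicatorEnds e').2) ∨
    OnOneSide (filledWengerPos (indicatorEnds e').1) (filledWengerPos (indicatorEnds e').2)
      (filledWengerPos (indicatorEnds e).1) (filledWengerPos (indicatorEnds e).2) := by
  decide +kernel

/-- The drawing of the indicator, squeezed into a thin rhombus. -/
theorem isStraightLineDrawing_wengerIndicator (τ : Fin 4 → MiniVertex → ℤˣ) :
    (wengerIndicator τ).graph.IsStraightLineDrawing
      (fun x => ((1 / 56 : ℝ) * (filledWengerPos x).1, (1 / 4480 : ℝ) * (filledWengerPos x).2))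
      (fun e => (indicatorEnds e).1) (fun e => (indicatorEnds e).2) := by
  refine SignedGraph.isStraightLineDrawing_of_int (by norm_num) (by norm_num)
    (wengerIndicator_ends τ) ?_ ?_ ?_ oneSide_indicatorEnds
  · decide +kernel
  · decide +kernel
  · decide +kernel

theorem abs_filledWengerPos_le : ∀ x, |(filledWengerPos x).2| ≤ 8 * (filledWengerPos x).1 ∧
    |(filledWengerPos x).2| ≤ 8 * (56 - (filledWengerPos x).1) := by
  decide +kernel

theorem isStraightLineDrawing_omegaGraph (τ : Fin 4 → MiniVertex → ℤˣ)
    (o : EdgeOrientation (⊤ : SimpleGraph (Fin 4))) :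
    ∃ pos tail head, (omegaGraph τ o).IsStraightLineDrawing pos tail head := by
  refine ⟨_, _, _, SignedIndicator.isStraightLineDrawing_replace
    (isStraightLineDrawing_wengerIndicator τ) (κ := 1 / 10) (posW := k4Pos) (by norm_num) ?_ ?_
    (fun x => ?_) k4Pos_injective (fun p q k hpq => similarity_k4Pos_ne_k4Pos p q k hpq)
    (fun p q p' q' hpq hpq' => similarity_k4Pos_ne p q p' q' hpq hpq')⟩
  · simp [wengerIndicator, filledWengerPos, wengerPos]
  · simp [wengerIndicator, filledWengerPos, wengerPos]
  · have h1 : |((filledWengerPos x).2 : ℝ)| ≤ 8 * (filledWengerPos x).1 := by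
      exact_mod_cast (abs_filledWengerPos_le x).1
    have h2 : |((filledWengerPos x).2 : ℝ)| ≤ 8 * (56 - (filledWengerPos x).1) := by
      exact_mod_cast (abs_filledWengerPos_le x).2
    simp only [abs_mul, abs_of_pos (by norm_num : (0 : ℝ) < 1 / 4480)]
    constructor <;> linarith

/-! ### Distances on the circle -/

namespace AddCircle

variable {r : ℝ}

theorem coe_half_add_coe_half :
    ((r / 2 : ℝ) : AddCircle r) + ((r / 2 : ℝ) : AddCircle r) = 0 := by
  rw [← AddCircle.coe_add, add_halves, AddCircle.coe_period]

theorem norm_coe_le_abs (x : ℝ) : ‖(x : AddCircle r)‖ ≤ |x| := 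
  QuotientAddGroup.norm_mk_le_norm

/-- Every point of the circle has a representative whose absolute value is the norm. -/
theorem exists_coe_eq_and_abs_eq_norm (x : AddCircle r) :
    ∃ t : ℝ, (t : AddCircle r) = x ∧ |t| = ‖x‖ := by
  induction x using QuotientAddGroup.induction_on with
  | H x =>
    refine ⟨x - round (r⁻¹ * x) * r, ?_, (AddCircle.norm_eq r).symm⟩
    rw [AddCircle.coe_sub, ← zsmul_eq_mul, AddCircle.coe_zsmul, AddCircle.coe_period, smul_zero,
      sub_zero]

theorem norm_coe_eq_min (hr : 0 < r) {x : ℝ} (hx : |x| ≤ r) :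
    ‖(x : AddCircle r)‖ = min |x| (r - |x|) := by
  have key (y : ℝ) (hy0 : 0 ≤ y) (hy : y ≤ r) : ‖(y : AddCircle r)‖ = min y (r - y) := by
    rcases le_total y (r / 2) with h | h
    · rw [min_eq_left (by linarith), (AddCircle.norm_coe_eq_abs_iff r hr.ne').2, abs_of_nonneg hy0]
      rwa [abs_of_nonneg hy0, abs_of_pos hr]
    · rw [min_eq_right (by linarith)]
      have hcoe : (y : AddCircle r) = ((y - r : ℝ) : AddCircle r) := by
        rw [AddCircle.coe_sub, AddCircle.coe_period, sub_zero]
      rw [hcoe, (AddCircle.norm_coe_eq_abs_iff r hr.ne').2, abs_of_nonpos (by linarith), neg_sub]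
      rw [abs_of_nonpos (by linarith), abs_of_pos hr]
      linarith
  rcases abs_cases x with ⟨h, h0⟩ | ⟨h, h0⟩
  · rw [h, key x h0 (h ▸ hx)]
  · rw [h, ← key (-x) (by linarith) (h ▸ hx), AddCircle.coe_neg, norm_neg]

theorem norm_add_coe_half (hr : 0 < r) (x : AddCircle r) :
    ‖x + ((r / 2 : ℝ) : AddCircle r)‖ = r / 2 - ‖x‖ := by
  obtain ⟨t, rfl, ht⟩ := exists_coe_eq_and_abs_eq_norm x
  have hle : |t| ≤ r / 2 :=
    ht.trans_le ((AddCircle.norm_le_half_period r hr.ne').trans_eq (by rw [abs_of_pos hr]))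
  rw [← ht, ← AddCircle.coe_add, norm_coe_eq_min (x := t + r / 2) hr]
  · rcases abs_cases t with ⟨h, h0⟩ | ⟨h, h0⟩
    · rw [abs_of_nonneg (by linarith), min_eq_right (by linarith)]
      linarith
    · rw [abs_of_nonneg (by linarith), min_eq_left (by linarith)]
      linarith
  · rw [abs_of_nonneg (by linarith [(abs_le.1 hle).1])]
    linarith [(abs_le.1 hle).2]

/-- The distances of a point from a second one and from the antipode of the second one add up to
half the circumference. -/
theorem dist_add_coe_half (hr : 0 < r) (x y : AddCircle r) :
    dist x (y + ((r / 2 : ℝ) : AddCircle r)) = r / 2 - dist x y := by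
  have h : x - (y + ((r / 2 : ℝ) : AddCircle r)) = x - y + ((r / 2 : ℝ) : AddCircle r) := by
    rw [← sub_sub, sub_eq_add_neg (x - y), neg_eq_of_add_eq_zero_left coe_half_add_coe_half]
  rw [dist_eq_norm, dist_eq_norm, h, norm_add_coe_half hr]

theorem dist_coe_half_add (x y : AddCircle r) :
    dist (x + ((r / 2 : ℝ) : AddCircle r)) y = dist x (y + ((r / 2 : ℝ) : AddCircle r)) := by
  rw [← dist_add_right _ _ ((r / 2 : ℝ) : AddCircle r), add_assoc, coe_half_add_coe_half, add_zero]

end AddCircle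

/-! ### Constructions of circular colorings -/

namespace SignedGraph

variable {V E : Type*} {G : SignedGraph V E} {r : ℝ} {f : V → AddCircle r}

theorem isCircularColoring_iff {tail head : E → V} (h : ∀ e, G.ends e = s(tail e, head e)) :
    G.IsCircularColoring r f ↔ ∀ e,
      (G.sign e = 1 → 1 ≤ dist (f (tail e)) (f (head e))) ∧
      (G.sign e = -1 → 1 ≤ dist (f (tail e)) (f (head e) + ((r / 2 : ℝ) : AddCircle r))) := by
  refine ⟨fun hf e => hf e _ _ (h e), fun hf e x y hxy => ?_⟩
  have hxy' := hf e
  rw [h e, Sym2.eq_iff] at hxy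
  obtain ⟨rfl, rfl⟩ | ⟨rfl, rfl⟩ := hxy
  · exact hxy'
  · rwa [dist_comm, ← AddCircle.dist_coe_half_add, dist_comm (_ + _)]

theorem isCircularColoring_addEdge_iff {x y : V} {ε : ℤˣ} :
    (G.addEdge x y ε).IsCircularColoring r f ↔ G.IsCircularColoring r f ∧
      (ε = 1 → 1 ≤ dist (f x) (f y)) ∧
      (ε = -1 → 1 ≤ dist (f x) (f y + ((r / 2 : ℝ) : AddCircle r))) := by
  constructor
  · exact fun h => ⟨fun e => h (some e), h none x y rfl⟩
  · rintro ⟨h, hxy⟩ (_ | e) x' y' he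
    · have he' : s(x, y) = s(x', y') := he
      rw [Sym2.eq_iff] at he'
      obtain ⟨rfl, rfl⟩ | ⟨rfl, rfl⟩ := he'
      · exact hxy
      · rwa [dist_comm, ← AddCircle.dist_coe_half_add, dist_comm (_ + _)]
    · exact h e x' y' he

theorem switch_switch_self (G : SignedGraph V E) (ρ : V → ℤˣ) :
    (G.switch ρ).switch ρ = G := by
  have h : ((G.switch ρ).switch ρ).sign = G.sign := by
    funext e
    simp only [SignedGraph.switch, ← mul_assoc, Int.units_mul_self, one_mul]
  exact congrArg (SignedGraph.mk G.ends) h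

/-- If a vertex set is switched, replacing the colors of its vertices by their antipodes turns
colorings into colorings. -/
theorem IsCircularColoring.switch (h : G.IsCircularColoring r f) (ρ : V → ℤˣ) :
    (G.switch ρ).IsCircularColoring r
      fun x => if ρ x = 1 then f x else f x + ((r / 2 : ℝ) : AddCircle r) := by
  intro e x y he
  have he' : G.ends e = s(x, y) := he
  have hs : (G.switch ρ).sign e = ρ x * ρ y * G.sign e := by simp [SignedGraph.switch, he']
  have h1 : (-1 : ℤˣ) ≠ 1 := by decide
  have h2 := h e x y he'
  rw [hs]
  rcases Int.units_eq_one_or (ρ x) with hx | hx <;>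
    rcases Int.units_eq_one_or (ρ y) with hy | hy <;>
    rcases Int.units_eq_one_or (G.sign e) with hz | hz <;>
    simp [hx, hy, hz, h1, h1.symm, AddCircle.dist_coe_half_add, add_assoc,
      AddCircle.coe_half_add_coe_half] at h2 ⊢ <;> exact h2

end SignedGraph

namespace SignedIndicator

variable {W V E : Type*} [DecidableEq V] {I : SignedIndicator V E} {G : SimpleGraph W}
  {o : EdgeOrientation G} {r : ℝ}

theorem isCircularColoring_comp_place {f : I.ReplaceVertex G → AddCircle r}
    (h : (I.replace G o).IsCircularColoring r f) (e : G.edgeSet) :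
    I.graph.IsCircularColoring r fun x => f (I.place G o e x) := by
  intro d x y hd
  exact h (e, d) _ _ (by simp [replace, hd])

/-- Colorings of the copies of the indicator that agree on the vertices of `G` form a coloring of
`G(𝓘)`. -/
theorem exists_isCircularColoring_replace (c : W → AddCircle r)
    (h : ∀ p q, G.Adj p q →
      ∃ f : V → AddCircle r, I.graph.IsCircularColoring r f ∧ f I.u = c p ∧ f I.v = c q) :
    ∃ f, (I.replace G o).IsCircularColoring r f := by
  have hadj (e : G.edgeSet) : G.Adj (o.toProd e).1 (o.toProd e).2 := by
    rw [← SimpleGraph.mem_edgeSet, o.mk_toProd]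
    exact e.2
  choose f hf hu hv using fun e : G.edgeSet => h _ _ (hadj e)
  let F : I.ReplaceVertex G → AddCircle r := Sum.elim c fun ex => f ex.1 ex.2
  have hF (e : G.edgeSet) (x : V) : F (I.place G o e x) = f e x := by
    unfold place
    split_ifs with h1 h2
    · simp [F, h1, hu]
    · simp [F, h2, hv]
    · simp [F]
  refine ⟨F, ?_⟩
  rintro ⟨e, d⟩ x y he
  have he' : (I.graph.ends d).map (I.place G o e) = s(x, y) := he
  induction hd : I.graph.ends d with
  | h a b =>
    rw [hd, Sym2.map_mk, Sym2.eq_iff] at he'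
    obtain ⟨rfl, rfl⟩ | ⟨rfl, rfl⟩ := he'
    · rw [hF, hF]
      exact hf e d a b hd
    · rw [hF, hF]
      exact hf e d b a (hd.trans Sym2.eq_swap)

end SignedIndicator

/-! ### Switchings of the mini-gadgets -/

/-- The switching of the vertex `z` of the mini-gadget. -/
def switchZ (p : MiniVertex) : ℤˣ := if p = MiniVertex.z then -1 else 1

/-- Admissibility determines the switching on the outer triangle up to a common sign, because all
four facial triangles have the same signs. -/
theorem IsAdmissibleSwitching.outer_eq {τ : Fin 4 → MiniVertex → ℤˣ} (h : IsAdmissibleSwitching τ)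
    (i : Fin 4) : τ i .y = τ i .x ∧ τ i .z = -τ i .x := by
  have hxy : τ i .x * τ i .y * (-1) = -1 := by
    fin_cases i
    · exact h 0 (0 : Fin 12) (20 : Fin 23) (by decide)
    · exact h 1 (0 : Fin 12) (10 : Fin 23) (by decide)
    · exact h 2 (0 : Fin 12) (17 : Fin 23) (by decide)
    · exact h 3 (0 : Fin 12) (12 : Fin 23) (by decide)
  have hyz : τ i .y * τ i .z * (-1) = 1 := by
    fin_cases i
    · exact h 0 (1 : Fin 12) (9 : Fin 23) (by decide)
    · exact h 1 (1 : Fin 12) (6 : Fin 23) (by decide)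
    · exact h 2 (1 : Fin 12) (7 : Fin 23) (by decide)
    · exact h 3 (1 : Fin 12) (8 : Fin 23) (by decide)
  revert hxy hyz
  generalize τ i .x = a
  generalize τ i .y = b
  generalize τ i .z = c
  revert a b c
  decide

instance : Fintype MiniVertex where
  elems := {.x, .y, .z, .a, .b, .c}
  complete p := by cases p <;> decide

/-- An admissible switching differs from the switching of the vertices `z` by a switching of the
inner vertices of the mini-gadgets. -/
def innerSwitch (τ : Fin 4 → MiniVertex → ℤˣ) : WengerVertex ⊕ Fin 4 × Fin 3 → ℤˣ :=
  Sum.elim (fun _ => 1) fun ij => τ ij.1 .x * τ ij.1 (![.a, .b, .c] ij.2)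

theorem switch_filledWenger {τ : Fin 4 → MiniVertex → ℤˣ} (h : IsAdmissibleSwitching τ) :
    (filledWenger fun _ => switchZ).switch (innerSwitch τ) = filledWenger τ := by
  have key : ∀ σ : MiniVertex → ℤˣ, σ .y = σ .x → σ .z = -σ .x → ∀ i f,
      ((filledWenger fun _ => switchZ).switch (innerSwitch fun _ => σ)).sign (Sum.inr (i, f)) =
        (filledWenger fun _ => σ).sign (Sum.inr (i, f)) := by
    decide +kernel
  have hsign : ((filledWenger fun _ => switchZ).switch (innerSwitch τ)).sign =
      (filledWenger τ).sign := by
    funext e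
    rcases e with e | ⟨i, f⟩
    · change Sym2.lift _ (Sym2.map _ (signedWenger.ends e)) * signedWenger.sign e =
        signedWenger.sign e
      induction signedWenger.ends e with
      | h a b => simp [innerSwitch]
    · have hi := key (τ i) (h.outer_eq i).1 (h.outer_eq i).2 i f
      fin_cases f <;> exact hi
  exact congrArg (SignedGraph.mk (filledWenger τ).ends) hsign

/-- A coloring of `W̃` for one admissible switching yields one for any other, with the same colors
on the vertices of the Wenger graph. -/
theorem exists_isCircularColoring_filledWenger {τ τ' : Fin 4 → MiniVertex → ℤˣ}
    (h : IsAdmissibleSwitching τ) (h' : IsAdmissibleSwitching τ') {r : ℝ}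
    {f : WengerVertex ⊕ Fin 4 × Fin 3 → AddCircle r}
    (hf : (filledWenger τ).IsCircularColoring r f) :
    ∃ f', (filledWenger τ').IsCircularColoring r f' ∧ ∀ x, f' (Sum.inl x) = f (Sum.inl x) := by
  have hz : (filledWenger fun _ => switchZ) = (filledWenger τ).switch (innerSwitch τ) := by
    rw [← switch_filledWenger h, SignedGraph.switch_switch_self]
  refine ⟨_, switch_filledWenger h' ▸ (hz ▸ hf.switch (innerSwitch τ)).switch (innerSwitch τ'),
    fun x => ?_⟩
  simp [innerSwitch]

/-! ### A coloring with circumference `14 / 3` -/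

/-- The colors `a / 9` and `b / 9` on the circle of circumference `14 / 3 = 42 / 9` are at distance
at least `1` if `a - b` is at least `9` away from the multiples of `42`. -/
theorem one_le_dist_of_emod {a b : ℤ} (h : 9 ≤ (a - b) % 42) (h' : (a - b) % 42 ≤ 33) :
    1 ≤ dist ((a / 9 : ℝ) : AddCircle (14 / 3 : ℝ)) ((b / 9 : ℝ) : AddCircle (14 / 3 : ℝ)) := by
  obtain ⟨s, hs⟩ : ∃ s, s = (a - b) % 42 := ⟨_, rfl⟩
  obtain ⟨k, hk⟩ : ∃ k, k = (a - b) / 42 := ⟨_, rfl⟩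
  have hab : (a : ℝ) - b = s + 42 * k := by
    have : a - b = s + 42 * k := by omega
    exact_mod_cast this
  have h1 : (9 : ℝ) ≤ s := by exact_mod_cast hs ▸ h
  have h2 : (s : ℝ) ≤ 33 := by exact_mod_cast hs ▸ h'
  have hcoe : ((a / 9 - b / 9 : ℝ) : AddCircle (14 / 3 : ℝ)) =
      ((s / 9 : ℝ) : AddCircle (14 / 3 : ℝ)) := by
    have : (a / 9 - b / 9 : ℝ) = s / 9 + k • (14 / 3 : ℝ) := by
      rw [zsmul_eq_mul]
      linarith
    rw [this, AddCircle.coe_add, AddCircle.coe_zsmul, AddCircle.coe_period, smul_zero, add_zero]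
  rw [dist_eq_norm, ← AddCircle.coe_sub, hcoe, AddCircle.norm_coe_eq_min (by norm_num),
    abs_of_nonneg (by linarith)]
  · exact le_min (by linarith) (by linarith)
  · rw [abs_of_nonneg (by linarith)]
    linarith

/-- Colorings of the indicator by multiples of `1 / 9` modulo `14 / 3`, for the switching of the
vertices `z`: in the `k`-th one, `u` and `v` have the colors `0` and `4 * (k + 1)`. -/
def baseColor (k : Fin 3) : WengerVertex ⊕ Fin 4 × Fin 3 → ℤ
  | .inl .u => 0
  | .inl .v => ![4, 8, 12] k
  | .inl .w => ![22, 27, 27] k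
  | .inl .z => ![37, 30, 30] k
  | .inl .t => ![30, 30, 3] k
  | .inl .x₁ => ![10, 9, 9] k
  | .inl .x₂ => ![31, 18, 18] k
  | .inl .x₃ => ![13, 39, 0] k
  | .inl .x₄ => ![34, 18, 9] k
  | .inl .x₅ => ![1, 0, 36] k
  | .inr (i, j) =>
    ![![![19, 10, 0], ![28, 0, 19], ![22, 10, 1], ![10, 19, 0]],
      ![![18, 9, 0], ![6, 36, 27], ![17, 0, 27], ![9, 0, 30]],
      ![![18, 6, 39], ![9, 0, 30], ![21, 0, 9], ![12, 33, 0]]] k i j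

/-- Colorings of the indicator in which `u` and `v` have the colors `4 * p` and `4 * q`: if `q < p`,
a reflection of the circle is used. -/
def pairColor (p q : Fin 4) (x : WengerVertex ⊕ Fin 4 × Fin 3) : ℤ :=
  if p < q then 4 * (p : ℕ) + baseColor (Fin.ofNat 3 (q - p - 1)) x
  else 4 * (p : ℕ) - baseColor (Fin.ofNat 3 (p - q - 1)) x

set_option maxRecDepth 10000 in
theorem pairColor_sub_emod : ∀ p q, p ≠ q → ∀ e,
    let s : ℤ := if (wengerIndicator fun _ => switchZ).graph.sign e = 1 then 0 else 21
    9 ≤ (pairColor p q (indicatorEnds e).1 - (pairColor p q (indicatorEnds e).2 + s)) % 42 ∧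
      (pairColor p q (indicatorEnds e).1 - (pairColor p q (indicatorEnds e).2 + s)) % 42 ≤ 33 := by
  decide +kernel

theorem pairColor_u_v : ∀ p q : Fin 4, p ≠ q → pairColor p q (Sum.inl .u) = 4 * (p : ℕ) ∧
    pairColor p q (Sum.inl .v) = 4 * (q : ℕ) := by
  decide +kernel

theorem isCircularColoring_pairColor {p q : Fin 4} (h : p ≠ q) :
    (wengerIndicator fun _ => switchZ).graph.IsCircularColoring (14 / 3)
      fun x => ((pairColor p q x / 9 : ℝ) : AddCircle (14 / 3 : ℝ)) := by
  rw [SignedGraph.isCircularColoring_iff (wengerIndicator_ends _)]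
  intro e
  have he := pairColor_sub_emod p q h e
  dsimp only at he
  refine ⟨fun hs => ?_, fun hs => ?_⟩
  · rw [if_pos hs, add_zero] at he
    exact one_le_dist_of_emod he.1 he.2
  · rw [if_neg (by rw [hs]; decide)] at he
    have := one_le_dist_of_emod he.1 he.2
    rw [← AddCircle.coe_add]
    convert this using 3
    push_cast
    ring

theorem exists_isCircularColoring_omegaGraph {τ : Fin 4 → MiniVertex → ℤˣ}
    (hτ : IsAdmissibleSwitching τ) (o : EdgeOrientation (⊤ : SimpleGraph (Fin 4))) :
    ∃ f, (omegaGraph τ o).IsCircularColoring (14 / 3) f := by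
  refine SignedIndicator.exists_isCircularColoring_replace
    (fun k => ((4 * (k : ℕ) / 9 : ℝ) : AddCircle (14 / 3 : ℝ))) fun p q hpq => ?_
  have h := isCircularColoring_pairColor (show p ≠ q from hpq)
  obtain ⟨hc, huv⟩ := SignedGraph.isCircularColoring_addEdge_iff.1 h
  obtain ⟨f, hf, hfx⟩ := exists_isCircularColoring_filledWenger isAdmissibleSwitching_z hτ hc
  have hu := pairColor_u_v p q hpq
  refine ⟨f, SignedGraph.isCircularColoring_addEdge_iff.2 ⟨hf, ?_⟩, ?_, ?_⟩
  · rwa [hfx, hfx]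
  · exact (hfx _).trans (by rw [hu.1]; push_cast; rfl)
  · exact (hfx _).trans (by rw [hu.2]; push_cast; rfl)

/-! ### Lifts of colorings to an interval -/

/-- The points of a circle of circumference `r` represented by `a, b ∈ [0, r]` have distance at
least `δ`. -/
def Apart (r δ a b : ℝ) : Prop :=
  δ ≤ b - a ∧ b - a ≤ r - δ ∨ δ ≤ a - b ∧ a - b ≤ r - δ

/-- The points of a circle of circumference `r` represented by `a, b ∈ [0, r]` have distance at
most `δ`. -/
def Close (r δ a b : ℝ) : Prop :=
  b - a ≤ δ ∧ a - b ≤ δ ∨ r - δ ≤ b - a ∨ r - δ ≤ a - b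

theorem Apart.reflect {r δ a b : ℝ} (h : Apart r δ a b) : Apart r δ (r - a) (r - b) := by
  refine h.symm.imp (fun h => ?_) (fun h => ?_) <;> constructor <;> linarith

theorem Close.reflect {r δ a b : ℝ} (h : Close r δ a b) : Close r δ (r - a) (r - b) := by
  refine h.imp (fun h => ?_) (fun h => h.symm.imp (fun h => ?_) (fun h => ?_))
  · constructor <;> linarith
  · linarith
  · linarith

theorem close_of_not_apart {r δ a b : ℝ} (h : ¬ Apart r δ a b) : Close r δ a b := by
  unfold Close
  by_contra hc
  push Not at hc
  obtain ⟨h1, h2, h3⟩ := hc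
  rcases le_or_gt (b - a) δ with h4 | h4
  · exact h (Or.inr ⟨(h1 h4).le, h3.le⟩)
  · exact h (Or.inl ⟨h4.le, h2.le⟩)

theorem apart_of_le_min {r δ a b : ℝ} (h : δ ≤ min |a - b| (r - |a - b|)) : Apart r δ a b := by
  rw [le_min_iff] at h
  rcases abs_cases (a - b) with ⟨h1, h2⟩ | ⟨h1, h2⟩ <;> rw [h1] at h
  · exact Or.inr ⟨h.1, by linarith⟩
  · exact Or.inl ⟨by linarith, by linarith⟩

theorem close_of_min_le {r δ a b : ℝ} (h : min |a - b| (r - |a - b|) ≤ δ) : Close r δ a b := by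
  rcases min_le_iff.1 h with h | h
  · rw [abs_le] at h
    exact Or.inl ⟨by linarith, by linarith⟩
  · rcases abs_cases (a - b) with ⟨h1, h2⟩ | ⟨h1, h2⟩ <;> rw [h1] at h
    · exact Or.inr (Or.inr (by linarith))
    · exact Or.inr (Or.inl (by linarith))

/-- Colors can be lifted to the interval `[0, r]` such that a given color is lifted to `0`. -/
theorem exists_lift {V : Type*} {r : ℝ} (hr : 0 < r) (φ : V → AddCircle r) (w : V) :
    ∃ l : V → ℝ, (∀ x, 0 ≤ l x ∧ l x ≤ r) ∧ l w = 0 ∧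
      ∀ x y, dist (φ x) (φ y) = min |l x - l y| (r - |l x - l y|) := by
  have h (x : V) : ∃ t : ℝ, (0 ≤ t ∧ t ≤ r) ∧ (x = w → t = 0) ∧ (t : AddCircle r) = φ x - φ w := by
    by_cases hx : x = w
    · exact ⟨0, ⟨le_rfl, hr.le⟩, fun _ => rfl, by simp [hx]⟩
    obtain ⟨t, ht, hn⟩ := AddCircle.exists_coe_eq_and_abs_eq_norm (φ x - φ w)
    have hle := (AddCircle.norm_le_half_period r (x := φ x - φ w) hr.ne')
    rw [← hn, abs_of_pos hr, abs_le] at hle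
    rcases le_total 0 t with h0 | h0
    · exact ⟨t, ⟨h0, by linarith⟩, fun h => absurd h hx, ht⟩
    · refine ⟨t + r, ⟨by linarith, by linarith⟩, fun h => absurd h hx, ?_⟩
      rw [AddCircle.coe_add, AddCircle.coe_period, add_zero, ht]
  choose l hl hw hφ using h
  refine ⟨l, hl, hw w rfl, fun x y => ?_⟩
  rw [← AddCircle.norm_coe_eq_min hr, AddCircle.coe_sub, hφ, hφ, sub_sub_sub_cancel_right,
    dist_eq_norm]
  rw [abs_le]
  constructor <;> linarith [(hl x).1, (hl x).2, (hl y).1, (hl y).2]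

/-! ### The mini-gadget -/

/-- In a coloring of the mini-gadget the vertices of the outer triangle cannot be too close to each
other. The color of `a` is near that of `z`, the color of `b` near that of `x`, and the color of `c`
near that of `y`, but they are far from the colors of `x`, `y` and `z`, respectively. If `x`, `y`
and `z` were within a short arc, then two of `a`, `b`, `c` would be on the same side of it, where
there is not enough space for both. -/
theorem miniGadget_dist {r : ℝ} (hr : 4 ≤ r) {x y z a b c : AddCircle r}
    (hab : 1 ≤ dist a b) (hbc : 1 ≤ dist b c) (hac : 1 ≤ dist a c)
    (hax : 1 ≤ dist a x) (hby : 1 ≤ dist b y) (hcz : 1 ≤ dist c z)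
    (haz : dist a z ≤ r / 2 - 1) (hbx : dist b x ≤ r / 2 - 1) (hcy : dist c y ≤ r / 2 - 1) :
    3 - r / 2 ≤ dist x y ∨ 3 - r / 2 ≤ dist y z ∨ 3 - r / 2 ≤ dist x z := by
  have hr0 : 0 < r := by linarith
  by_contra! hclose
  obtain ⟨hxy, hyz, hxz⟩ := hclose
  obtain ⟨Y, hY, hY'⟩ := AddCircle.exists_coe_eq_and_abs_eq_norm (y - x)
  obtain ⟨Z, hZ, hZ'⟩ := AddCircle.exists_coe_eq_and_abs_eq_norm (z - x)
  obtain ⟨A, hA, hA'⟩ := AddCircle.exists_coe_eq_and_abs_eq_norm (a - z)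
  obtain ⟨B, hB, hB'⟩ := AddCircle.exists_coe_eq_and_abs_eq_norm (b - x)
  obtain ⟨C, hC, hC'⟩ := AddCircle.exists_coe_eq_and_abs_eq_norm (c - y)
  rw [← dist_eq_norm] at hY' hZ' hA' hB' hC'
  rw [dist_comm] at hY' hZ'
  have hY2 := abs_lt.1 (hY'.trans_lt hxy)
  have hZ2 := abs_lt.1 (hZ'.trans_lt hxz)
  have hA2 := abs_le.1 (hA'.trans_le haz)
  have hB2 := abs_le.1 (hB'.trans_le hbx)
  have hC2 := abs_le.1 (hC'.trans_le hcy)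
  have hYZ : |Y - Z| < 3 - r / 2 := by
    have h1 : dist y z = min |Y - Z| (r - |Y - Z|) := by
      rw [← AddCircle.norm_coe_eq_min hr0, AddCircle.coe_sub, hY, hZ, sub_sub_sub_cancel_right,
        dist_eq_norm]
      rw [abs_le]
      constructor <;> linarith
    have h2 : |Y - Z| < r - (3 - r / 2) := by
      rw [abs_lt]
      constructor <;> linarith
    rw [h1, min_lt_iff] at hyz
    rcases hyz with h | h <;> linarith
  have hYZ2 := abs_lt.1 hYZ
  have far {p q : AddCircle r} {t : ℝ} (h : 1 ≤ dist p q) (ht : (t : AddCircle r) = p - q) :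
      1 ≤ |t| := by
    rw [dist_eq_norm, ← ht] at h
    exact h.trans (AddCircle.norm_coe_le_abs t)
  have fax : 1 ≤ |Z + A| := far hax (by rw [AddCircle.coe_add, hZ, hA]; abel)
  have fby : 1 ≤ |B - Y| := far hby (by rw [AddCircle.coe_sub, hB, hY]; abel)
  have fcz : 1 ≤ |Y + C - Z| :=
    far hcz (by rw [AddCircle.coe_sub, AddCircle.coe_add, hY, hC, hZ]; abel)
  have fab : 1 ≤ |Z + A - B| :=
    far hab (by rw [AddCircle.coe_sub, AddCircle.coe_add, hZ, hA, hB]; abel)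
  have fbc : 1 ≤ |B - (Y + C)| :=
    far hbc (by rw [AddCircle.coe_sub, AddCircle.coe_add, hY, hC, hB]; abel)
  have fac : 1 ≤ |Z + A - (Y + C)| := far hac (by
    rw [AddCircle.coe_sub, AddCircle.coe_add, AddCircle.coe_add, hZ, hA, hY, hC]; abel)
  rw [le_abs] at fax fby fcz fab fbc fac
  rcases fax with fax | fax <;> rcases fby with fby | fby <;> rcases fcz with fcz | fcz
  all_goals first
    | rcases fab with fab | fab <;> linarith
    | rcases fbc with fbc | fbc <;> linarith
    | rcases fac with fac | fac <;> linarith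

/-! ### The signed Wenger graph -/

/-- A lift of a coloring of the signed Wenger graph to the interval `[0, r]`, in which the color of
`w` is an end of the interval, and the facial triangles satisfy the condition for the extension to
the mini-gadgets. -/
structure IsWengerLift (r : ℝ) (l : WengerVertex → ℝ) : Prop where
  mem : ∀ p, 0 ≤ l p ∧ l p ≤ r
  w_eq : l .w = 0 ∨ l .w = r
  apart : ∀ p q, (p, q, 1) ∈ WengerVertex.edges → Apart r 1 (l p) (l q)
  close : ∀ p q, (p, q, -1) ∈ WengerVertex.edges → Close r (r / 2 - 1) (l p) (l q)
  triangle : ∀ i, Apart r (3 - r / 2) (l (WengerVertex.corners i).1)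
      (l (WengerVertex.corners i).2.1) ∨
    Close r (r - 3) (l (WengerVertex.corners i).2.1) (l (WengerVertex.corners i).2.2) ∨
    Close r (r - 3) (l (WengerVertex.corners i).1) (l (WengerVertex.corners i).2.2)

namespace IsWengerLift

open WengerVertex

variable {r : ℝ} {l : WengerVertex → ℝ}

theorem reflect (h : IsWengerLift r l) : IsWengerLift r fun p => r - l p where
  mem p := ⟨by linarith [(h.mem p).2], by linarith [(h.mem p).1]⟩
  w_eq := h.w_eq.symm.imp (fun h => by rw [h, sub_self]) (fun h => by rw [h, sub_zero])
  apart p q hpq := (h.apart p q hpq).reflect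
  close p q hpq := (h.close p q hpq).reflect
  triangle i := (h.triangle i).imp Apart.reflect (Or.imp Close.reflect Close.reflect)

/-- The neighbors of `w` are lifted to `[1, r - 1]`. -/
theorem rim (h : IsWengerLift r l) {p : WengerVertex} (hp : (w, p, 1) ∈ edges) :
    1 ≤ l p ∧ l p ≤ r - 1 := by
  have := h.mem p
  rcases h.apart w p hp with h1 | h1 <;> rcases h.w_eq with h2 | h2 <;> rw [h2] at h1 <;>
    constructor <;> linarith

set_option maxHeartbeats 1000000 in
/-- The case in which `x₁` is the vertex of the rim between its neighbors. Then each of `x₂, …, x₅`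
is lifted close to one end of `[1, r - 1]`. Each further edge or triangle allows a few linear
relations between the lifts of `z`, `t`, `u`, `v`, and no choice of them is consistent with a
distance of `u` and `v` below `4 / 9`. -/
theorem apart_of_middle_x₁ (h : IsWengerLift r l) (hr : 4 ≤ r) (hr' : r < 14 / 3)
    (h₁₂ : 1 ≤ l x₂ - l x₁) (h₃₄ : 1 ≤ l x₄ - l x₃)
    (h₄₅ : 1 ≤ l x₄ - l x₅) (h₅₁ : 1 ≤ l x₁ - l x₅) :
    Apart r (4 / 9) (l u) (l v) := by
  by_contra huv
  replace huv := close_of_not_apart huv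
  obtain ⟨hx₁, hx₁'⟩ := h.rim (p := x₁) (by decide)
  obtain ⟨hx₂, hx₂'⟩ := h.rim (p := x₂) (by decide)
  obtain ⟨hx₃, hx₃'⟩ := h.rim (p := x₃) (by decide)
  obtain ⟨hx₄, hx₄'⟩ := h.rim (p := x₄) (by decide)
  obtain ⟨hx₅, hx₅'⟩ := h.rim (p := x₅) (by decide)
  obtain ⟨ht, ht'⟩ := h.mem t
  obtain ⟨hu, hu'⟩ := h.mem u
  obtain ⟨hv, hv'⟩ := h.mem v
  have htx₄x₅ : Apart r (3 - r / 2) (l t) (l x₄) ∨ Close r (r - 3) (l x₄) (l x₅) ∨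
      Close r (r - 3) (l t) (l x₅) := h.triangle 3
  rcases h.close t x₄ (by decide) with ⟨tx₄, tx₄'⟩ | tx₄ | tx₄ <;> try linarith
  all_goals rcases h.apart t x₅ (by decide) with ⟨tx₅, tx₅'⟩ | ⟨tx₅, tx₅'⟩ <;> try linarith
  all_goals rcases h.apart v t (by decide) with ⟨vt, vt'⟩ | ⟨vt, vt'⟩ <;> try linarith
  all_goals rcases h.close v x₄ (by decide) with ⟨vx₄, vx₄'⟩ | vx₄ | vx₄ <;> try linarith
  all_goals rcases h.apart v x₃ (by decide) with ⟨vx₃, vx₃'⟩ | ⟨vx₃, vx₃'⟩ <;> try linarith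
  all_goals rcases huv with ⟨uv, uv'⟩ | uv | uv <;> try linarith
  all_goals rcases h.close u x₅ (by decide) with ⟨ux₅, ux₅'⟩ | ux₅ | ux₅ <;> try linarith
  all_goals rcases h.close u t (by decide) with ⟨ut, ut'⟩ | ut | ut <;> try linarith
  all_goals rcases h.apart u x₁ (by decide) with ⟨ux₁, ux₁'⟩ | ⟨ux₁, ux₁'⟩ <;> try linarith
  all_goals rcases htx₄x₅ with
    (⟨h₁, h₂⟩ | ⟨h₁, h₂⟩) | (⟨h₁, h₂⟩ | h₁ | h₁) | (⟨h₁, h₂⟩ | h₁ | h₁) <;> try linarith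

set_option maxHeartbeats 1000000 in
/-- The case in which `x₂` is the vertex of the rim between its neighbors. -/
theorem apart_of_middle_x₂ (h : IsWengerLift r l) (hr : 4 ≤ r) (hr' : r < 14 / 3)
    (h₁₂ : 1 ≤ l x₂ - l x₁) (h₂₃ : 1 ≤ l x₃ - l x₂) (h₃₄ : 1 ≤ l x₃ - l x₄)
    (h₄₅ : 1 ≤ l x₅ - l x₄) (h₅₁ : 1 ≤ l x₅ - l x₁) :
    Apart r (4 / 9) (l u) (l v) := by
  by_contra huv
  replace huv := close_of_not_apart huv
  obtain ⟨hx₁, hx₁'⟩ := h.rim (p := x₁) (by decide)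
  obtain ⟨hx₂, hx₂'⟩ := h.rim (p := x₂) (by decide)
  obtain ⟨hx₃, hx₃'⟩ := h.rim (p := x₃) (by decide)
  obtain ⟨hx₄, hx₄'⟩ := h.rim (p := x₄) (by decide)
  obtain ⟨hx₅, hx₅'⟩ := h.rim (p := x₅) (by decide)
  obtain ⟨hz, hz'⟩ := h.mem z
  obtain ⟨ht, ht'⟩ := h.mem t
  obtain ⟨hu, hu'⟩ := h.mem u
  obtain ⟨hv, hv'⟩ := h.mem v
  have htx₄x₅ : Apart r (3 - r / 2) (l t) (l x₄) ∨ Close r (r - 3) (l x₄) (l x₅) ∨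
      Close r (r - 3) (l t) (l x₅) := h.triangle 3
  rcases h.close z x₂ (by decide) with ⟨zx₂, zx₂'⟩ | zx₂ | zx₂ <;> try linarith
  all_goals rcases h.apart z x₃ (by decide) with ⟨zx₃, zx₃'⟩ | ⟨zx₃, zx₃'⟩ <;> try linarith
  all_goals rcases h.close u x₅ (by decide) with ⟨ux₅, ux₅'⟩ | ux₅ | ux₅ <;> try linarith
  all_goals rcases h.apart u x₁ (by decide) with ⟨ux₁, ux₁'⟩ | ⟨ux₁, ux₁'⟩ <;> try linarith
  all_goals rcases h.apart u x₂ (by decide) with ⟨ux₂, ux₂'⟩ | ⟨ux₂, ux₂'⟩ <;> try linarith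
  all_goals rcases h.close u z (by decide) with ⟨uz, uz'⟩ | uz | uz <;> try linarith
  all_goals rcases huv with ⟨uv, uv'⟩ | uv | uv <;> try linarith
  all_goals rcases h.apart v x₃ (by decide) with ⟨vx₃, vx₃'⟩ | ⟨vx₃, vx₃'⟩ <;> try linarith
  all_goals rcases h.apart v z (by decide) with ⟨vz, vz'⟩ | ⟨vz, vz'⟩ <;> try linarith
  all_goals rcases h.apart v t (by decide) with ⟨vt, vt'⟩ | ⟨vt, vt'⟩ <;> try linarith
  all_goals rcases h.apart t x₅ (by decide) with ⟨tx₅, tx₅'⟩ | ⟨tx₅, tx₅'⟩ <;> try linarith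
  all_goals rcases h.close v x₄ (by decide) with ⟨vx₄, vx₄'⟩ | vx₄ | vx₄ <;> try linarith
  all_goals rcases h.close u t (by decide) with ⟨ut, ut'⟩ | ut | ut <;> try linarith
  all_goals rcases htx₄x₅ with
    (⟨h₁, h₂⟩ | ⟨h₁, h₂⟩) | (⟨h₁, h₂⟩ | h₁ | h₁) | (⟨h₁, h₂⟩ | h₁ | h₁) <;> try linarith

set_option maxHeartbeats 1000000 in
/-- The case in which `x₃` is the vertex of the rim between its neighbors. -/
theorem apart_of_middle_x₃ (h : IsWengerLift r l) (hr : 4 ≤ r) (hr' : r < 14 / 3)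
    (h₁₂ : 1 ≤ l x₂ - l x₁) (h₂₃ : 1 ≤ l x₂ - l x₃) (h₃₄ : 1 ≤ l x₃ - l x₄)
    (h₅₁ : 1 ≤ l x₅ - l x₁) :
    Apart r (4 / 9) (l u) (l v) := by
  by_contra huv
  replace huv := close_of_not_apart huv
  obtain ⟨hx₁, hx₁'⟩ := h.rim (p := x₁) (by decide)
  obtain ⟨hx₂, hx₂'⟩ := h.rim (p := x₂) (by decide)
  obtain ⟨hx₃, hx₃'⟩ := h.rim (p := x₃) (by decide)
  obtain ⟨hx₄, hx₄'⟩ := h.rim (p := x₄) (by decide)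
  obtain ⟨hx₅, hx₅'⟩ := h.rim (p := x₅) (by decide)
  obtain ⟨hz, hz'⟩ := h.mem z
  obtain ⟨ht, ht'⟩ := h.mem t
  obtain ⟨hu, hu'⟩ := h.mem u
  obtain ⟨hv, hv'⟩ := h.mem v
  have htx₄x₅ : Apart r (3 - r / 2) (l t) (l x₄) ∨ Close r (r - 3) (l x₄) (l x₅) ∨
      Close r (r - 3) (l t) (l x₅) := h.triangle 3
  rcases h.close z x₂ (by decide) with ⟨zx₂, zx₂'⟩ | zx₂ | zx₂ <;> try linarith
  all_goals rcases h.apart z x₃ (by decide) with ⟨zx₃, zx₃'⟩ | ⟨zx₃, zx₃'⟩ <;> try linarith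
  all_goals rcases h.apart v z (by decide) with ⟨vz, vz'⟩ | ⟨vz, vz'⟩ <;> try linarith
  all_goals rcases h.close v x₄ (by decide) with ⟨vx₄, vx₄'⟩ | vx₄ | vx₄ <;> try linarith
  all_goals rcases h.apart v x₃ (by decide) with ⟨vx₃, vx₃'⟩ | ⟨vx₃, vx₃'⟩ <;> try linarith
  all_goals rcases huv with ⟨uv, uv'⟩ | uv | uv <;> try linarith
  all_goals rcases h.close u z (by decide) with ⟨uz, uz'⟩ | uz | uz <;> try linarith
  all_goals rcases h.apart u x₁ (by decide) with ⟨ux₁, ux₁'⟩ | ⟨ux₁, ux₁'⟩ <;> try linarith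
  all_goals rcases h.close u x₅ (by decide) with ⟨ux₅, ux₅'⟩ | ux₅ | ux₅ <;> try linarith
  all_goals rcases h.apart u x₂ (by decide) with ⟨ux₂, ux₂'⟩ | ⟨ux₂, ux₂'⟩ <;> try linarith
  all_goals rcases h.apart v t (by decide) with ⟨vt, vt'⟩ | ⟨vt, vt'⟩ <;> try linarith
  all_goals rcases h.apart t x₅ (by decide) with ⟨tx₅, tx₅'⟩ | ⟨tx₅, tx₅'⟩ <;> try linarith
  all_goals rcases h.close u t (by decide) with ⟨ut, ut'⟩ | ut | ut <;> try linarith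
  all_goals rcases htx₄x₅ with
    (⟨h₁, h₂⟩ | ⟨h₁, h₂⟩) | (⟨h₁, h₂⟩ | h₁ | h₁) | (⟨h₁, h₂⟩ | h₁ | h₁) <;> try linarith

set_option maxHeartbeats 1000000 in
/-- The case in which `x₄` is the vertex of the rim between its neighbors. -/
theorem apart_of_middle_x₄ (h : IsWengerLift r l) (hr' : r < 14 / 3)
    (h₁₂ : 1 ≤ l x₂ - l x₁) (h₂₃ : 1 ≤ l x₂ - l x₃) (h₃₄ : 1 ≤ l x₄ - l x₃)
    (h₄₅ : 1 ≤ l x₅ - l x₄) (h₅₁ : 1 ≤ l x₅ - l x₁) :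
    Apart r (4 / 9) (l u) (l v) := by
  by_contra huv
  replace huv := close_of_not_apart huv
  obtain ⟨hx₁, hx₁'⟩ := h.rim (p := x₁) (by decide)
  obtain ⟨hx₂, hx₂'⟩ := h.rim (p := x₂) (by decide)
  obtain ⟨hx₃, hx₃'⟩ := h.rim (p := x₃) (by decide)
  obtain ⟨hx₄, hx₄'⟩ := h.rim (p := x₄) (by decide)
  obtain ⟨hx₅, hx₅'⟩ := h.rim (p := x₅) (by decide)
  obtain ⟨hz, hz'⟩ := h.mem z
  obtain ⟨ht, ht'⟩ := h.mem t
  obtain ⟨hu, hu'⟩ := h.mem u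
  obtain ⟨hv, hv'⟩ := h.mem v
  have hzx₂x₃ : Apart r (3 - r / 2) (l z) (l x₂) ∨ Close r (r - 3) (l x₂) (l x₃) ∨
      Close r (r - 3) (l z) (l x₃) := h.triangle 1
  have hux₅x₁ : Apart r (3 - r / 2) (l u) (l x₅) ∨ Close r (r - 3) (l x₅) (l x₁) ∨
      Close r (r - 3) (l u) (l x₁) := h.triangle 0
  rcases h.close t x₄ (by decide) with ⟨tx₄, tx₄'⟩ | tx₄ | tx₄ <;> try linarith
  all_goals rcases h.apart t x₅ (by decide) with ⟨tx₅, tx₅'⟩ | ⟨tx₅, tx₅'⟩ <;> try linarith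
  all_goals rcases h.close v x₄ (by decide) with ⟨vx₄, vx₄'⟩ | vx₄ | vx₄ <;> try linarith
  all_goals rcases huv with ⟨uv, uv'⟩ | uv | uv <;> try linarith
  all_goals rcases h.apart v x₃ (by decide) with ⟨vx₃, vx₃'⟩ | ⟨vx₃, vx₃'⟩ <;> try linarith
  all_goals rcases h.close u x₅ (by decide) with ⟨ux₅, ux₅'⟩ | ux₅ | ux₅ <;> try linarith
  all_goals rcases h.close u t (by decide) with ⟨ut, ut'⟩ | ut | ut <;> try linarith
  all_goals rcases h.close z x₂ (by decide) with ⟨zx₂, zx₂'⟩ | zx₂ | zx₂ <;> try linarith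
  all_goals rcases h.close u z (by decide) with ⟨uz, uz'⟩ | uz | uz <;> try linarith
  all_goals rcases h.apart u x₂ (by decide) with ⟨ux₂, ux₂'⟩ | ⟨ux₂, ux₂'⟩ <;> try linarith
  all_goals rcases h.apart v z (by decide) with ⟨vz, vz'⟩ | ⟨vz, vz'⟩ <;> try linarith
  all_goals rcases hzx₂x₃ with
    (⟨h₁, h₂⟩ | ⟨h₁, h₂⟩) | (⟨h₁, h₂⟩ | h₁ | h₁) | (⟨h₁, h₂⟩ | h₁ | h₁) <;> try linarith
  all_goals rcases hux₅x₁ with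
    (⟨h₁, h₂⟩ | ⟨h₁, h₂⟩) | (⟨h₁, h₂⟩ | h₁ | h₁) | (⟨h₁, h₂⟩ | h₁ | h₁) <;> try linarith

set_option maxHeartbeats 1000000 in
/-- The case in which `x₅` is the vertex of the rim between its neighbors. -/
theorem apart_of_middle_x₅ (h : IsWengerLift r l) (hr' : r < 14 / 3)
    (h₁₂ : 1 ≤ l x₂ - l x₁) (h₂₃ : 1 ≤ l x₂ - l x₃) (h₃₄ : 1 ≤ l x₄ - l x₃)
    (h₄₅ : 1 ≤ l x₄ - l x₅) (h₅₁ : 1 ≤ l x₅ - l x₁) :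
    Apart r (4 / 9) (l u) (l v) := by
  by_contra huv
  replace huv := close_of_not_apart huv
  obtain ⟨hx₁, hx₁'⟩ := h.rim (p := x₁) (by decide)
  obtain ⟨hx₂, hx₂'⟩ := h.rim (p := x₂) (by decide)
  obtain ⟨hx₃, hx₃'⟩ := h.rim (p := x₃) (by decide)
  obtain ⟨hx₄, hx₄'⟩ := h.rim (p := x₄) (by decide)
  obtain ⟨hx₅, hx₅'⟩ := h.rim (p := x₅) (by decide)
  obtain ⟨hz, hz'⟩ := h.mem z
  obtain ⟨ht, ht'⟩ := h.mem t
  obtain ⟨hu, hu'⟩ := h.mem u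
  obtain ⟨hv, hv'⟩ := h.mem v
  have hvx₄x₃ : Apart r (3 - r / 2) (l v) (l x₄) ∨ Close r (r - 3) (l x₄) (l x₃) ∨
      Close r (r - 3) (l v) (l x₃) := h.triangle 2
  have hzx₂x₃ : Apart r (3 - r / 2) (l z) (l x₂) ∨ Close r (r - 3) (l x₂) (l x₃) ∨
      Close r (r - 3) (l z) (l x₃) := h.triangle 1
  rcases h.close u x₅ (by decide) with ⟨ux₅, ux₅'⟩ | ux₅ | ux₅ <;> try linarith
  all_goals rcases h.apart u x₁ (by decide) with ⟨ux₁, ux₁'⟩ | ⟨ux₁, ux₁'⟩ <;> try linarith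
  all_goals rcases huv with ⟨uv, uv'⟩ | uv | uv <;> try linarith
  all_goals rcases h.close z x₂ (by decide) with ⟨zx₂, zx₂'⟩ | zx₂ | zx₂ <;> try linarith
  all_goals rcases h.close u z (by decide) with ⟨uz, uz'⟩ | uz | uz <;> try linarith
  all_goals rcases h.apart u x₂ (by decide) with ⟨ux₂, ux₂'⟩ | ⟨ux₂, ux₂'⟩ <;> try linarith
  all_goals rcases h.apart z x₃ (by decide) with ⟨zx₃, zx₃'⟩ | ⟨zx₃, zx₃'⟩ <;> try linarith
  all_goals rcases h.apart v z (by decide) with ⟨vz, vz'⟩ | ⟨vz, vz'⟩ <;> try linarith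
  all_goals rcases h.apart v x₃ (by decide) with ⟨vx₃, vx₃'⟩ | ⟨vx₃, vx₃'⟩ <;> try linarith
  all_goals rcases h.close u t (by decide) with ⟨ut, ut'⟩ | ut | ut <;> try linarith
  all_goals rcases h.close t x₄ (by decide) with ⟨tx₄, tx₄'⟩ | tx₄ | tx₄ <;> try linarith
  all_goals rcases h.apart t x₅ (by decide) with ⟨tx₅, tx₅'⟩ | ⟨tx₅, tx₅'⟩ <;> try linarith
  all_goals rcases h.apart v t (by decide) with ⟨vt, vt'⟩ | ⟨vt, vt'⟩ <;> try linarith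
  all_goals rcases hvx₄x₃ with
    (⟨h₁, h₂⟩ | ⟨h₁, h₂⟩) | (⟨h₁, h₂⟩ | h₁ | h₁) | (⟨h₁, h₂⟩ | h₁ | h₁) <;> try linarith
  all_goals rcases hzx₂x₃ with
    (⟨h₁, h₂⟩ | ⟨h₁, h₂⟩) | (⟨h₁, h₂⟩ | h₁ | h₁) | (⟨h₁, h₂⟩ | h₁ | h₁) <;> try linarith

/-- Going around the rim of the wheel, the lifts go up and down by steps of at least `1` inside an
interval of length `r - 2 < 3`. Hence no three consecutive steps have the same direction, and as
the rim is an odd cycle, exactly one of its vertices lies between its two neighbors. -/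
theorem apart_of_one_le_sub (h : IsWengerLift r l) (hr : 4 ≤ r) (hr' : r < 14 / 3)
    (h₁₂ : 1 ≤ l x₂ - l x₁) : Apart r (4 / 9) (l u) (l v) := by
  obtain ⟨hx₁, hx₁'⟩ := h.rim (p := x₁) (by decide)
  obtain ⟨hx₂, hx₂'⟩ := h.rim (p := x₂) (by decide)
  obtain ⟨hx₃, hx₃'⟩ := h.rim (p := x₃) (by decide)
  obtain ⟨hx₄, hx₄'⟩ := h.rim (p := x₄) (by decide)
  obtain ⟨hx₅, hx₅'⟩ := h.rim (p := x₅) (by decide)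
  rcases h.apart x₂ x₃ (by decide) with ⟨h₂₃, -⟩ | ⟨h₂₃, -⟩ <;>
    rcases h.apart x₃ x₄ (by decide) with ⟨h₃₄, -⟩ | ⟨h₃₄, -⟩ <;>
    rcases h.apart x₄ x₅ (by decide) with ⟨h₄₅, -⟩ | ⟨h₄₅, -⟩ <;>
    rcases h.apart x₅ x₁ (by decide) with ⟨h₅₁, -⟩ | ⟨h₅₁, -⟩
  -- The other patterns contain two consecutive rim vertices between their neighbors.
  all_goals first
    | exact h.apart_of_middle_x₁ hr hr' h₁₂ h₃₄ h₄₅ h₅₁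
    | exact h.apart_of_middle_x₂ hr hr' h₁₂ h₂₃ h₃₄ h₄₅ h₅₁
    | exact h.apart_of_middle_x₃ hr hr' h₁₂ h₂₃ h₃₄ h₅₁
    | exact h.apart_of_middle_x₄ hr' h₁₂ h₂₃ h₃₄ h₄₅ h₅₁
    | exact h.apart_of_middle_x₅ hr' h₁₂ h₂₃ h₃₄ h₄₅ h₅₁
    | (exfalso; linarith)

theorem apart_u_v (h : IsWengerLift r l) (hr : 4 ≤ r) (hr' : r < 14 / 3) :
    Apart r (4 / 9) (l u) (l v) := by
  rcases h.apart x₁ x₂ (by decide) with ⟨h₁₂, -⟩ | ⟨h₁₂, -⟩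
  · exact h.apart_of_one_le_sub hr hr' h₁₂
  · simpa using (h.reflect.apart_of_one_le_sub hr hr' (by linarith)).reflect

end IsWengerLift

/-! ### Colorings with circumference less than `14 / 3` -/

theorem Apart.le_min_abs {r δ a b : ℝ} (hδ : 0 ≤ δ) (h : Apart r δ a b) :
    δ ≤ min |a - b| (r - |a - b|) := by
  rcases h with ⟨h1, h2⟩ | ⟨h1, h2⟩
  · rw [abs_of_nonpos (by linarith)]
    exact le_min (by linarith) (by linarith)
  · rw [abs_of_nonneg (by linarith)]
    exact le_min (by linarith) (by linarith)

/-- The condition that the mini-gadget filling a facial triangle imposes on the corners. -/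
theorem triangle_dist_of_isCircularColoring {r : ℝ} (hr : 4 ≤ r)
    {φ : WengerVertex ⊕ Fin 4 × Fin 3 → AddCircle r}
    (hφ : (filledWenger fun _ => switchZ).IsCircularColoring r φ) (i : Fin 4) :
    3 - r / 2 ≤ dist (φ (fillPlace i .x)) (φ (fillPlace i .y)) ∨
      dist (φ (fillPlace i .y)) (φ (fillPlace i .z)) ≤ r - 3 ∨
      dist (φ (fillPlace i .x)) (φ (fillPlace i .z)) ≤ r - 3 := by
  have hr0 : 0 < r := by linarith
  have edge (f : Fin 9) {p q : MiniVertex} (hf : miniGadgetInner.ends f = s(p, q)) :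
      ((miniGadgetInner.switch switchZ).sign f = 1 →
        1 ≤ dist (φ (fillPlace i p)) (φ (fillPlace i q))) ∧
      ((miniGadgetInner.switch switchZ).sign f = -1 →
        1 ≤ r / 2 - dist (φ (fillPlace i p)) (φ (fillPlace i q))) := by
    rw [← AddCircle.dist_add_coe_half hr0]
    refine hφ (Sum.inr (i, f)) _ _ ?_
    change (miniGadgetInner.ends f).map (fillPlace i) = _
    rw [hf, Sym2.map_mk]
  have hab := (edge 0 (p := .a) (q := .b) rfl).1 (by decide)
  have hbc := (edge 1 (p := .b) (q := .c) rfl).1 (by decide)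
  have hac := (edge 2 (p := .a) (q := .c) rfl).1 (by decide)
  have hax := (edge 3 (p := .a) (q := .x) rfl).1 (by decide)
  have hby := (edge 4 (p := .b) (q := .y) rfl).1 (by decide)
  have hcz := (edge 5 (p := .c) (q := .z) rfl).2 (by decide)
  have haz := (edge 6 (p := .a) (q := .z) rfl).1 (by decide)
  have hbx := (edge 7 (p := .b) (q := .x) rfl).2 (by decide)
  have hcy := (edge 8 (p := .c) (q := .y) rfl).2 (by decide)
  -- The mini-gadget is switched at `z`, so that the antipode of the color of `z` is to be used.
  have := miniGadget_dist (z := φ (fillPlace i .z) + ((r / 2 : ℝ) : AddCircle r)) hr hab hbc hac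
    hax hby (by rwa [AddCircle.dist_add_coe_half hr0])
    (by rw [AddCircle.dist_add_coe_half hr0]; linarith) (by linarith) (by linarith)
  rw [AddCircle.dist_add_coe_half hr0, AddCircle.dist_add_coe_half hr0] at this
  exact this.imp id (Or.imp (fun h => by linarith) (fun h => by linarith))

theorem exists_isWengerLift {r : ℝ} (hr : 4 ≤ r) {φ : WengerVertex ⊕ Fin 4 × Fin 3 → AddCircle r}
    (hφ : (filledWenger fun _ => switchZ).IsCircularColoring r φ) :
    ∃ l, IsWengerLift r l ∧ ∀ p q, dist (φ (Sum.inl p)) (φ (Sum.inl q)) =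
      min |l p - l q| (r - |l p - l q|) := by
  have hr0 : 0 < r := by linarith
  obtain ⟨l, hl, hw, hdist⟩ := exists_lift hr0 (fun p => φ (Sum.inl p)) .w
  have edge {p q : WengerVertex} {ε : ℤˣ} (h : (p, q, ε) ∈ WengerVertex.edges) :
      (ε = 1 → 1 ≤ dist (φ (Sum.inl p)) (φ (Sum.inl q))) ∧
      (ε = -1 → 1 ≤ r / 2 - dist (φ (Sum.inl p)) (φ (Sum.inl q))) := by
    obtain ⟨n, hn⟩ := List.mem_iff_get.1 h
    have hs : signedWenger.sign n = ε :=
      congrArg (fun e : WengerVertex × WengerVertex × ℤˣ => e.2.2) hn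
    have he : signedWenger.ends n = s(p, q) :=
      congrArg (fun e : WengerVertex × WengerVertex × ℤˣ => s(e.1, e.2.1)) hn
    rw [← AddCircle.dist_add_coe_half hr0, ← hs]
    refine hφ (Sum.inl n) _ _ ?_
    change (signedWenger.ends n).map Sum.inl = _
    rw [he, Sym2.map_mk]
  refine ⟨l, ⟨hl, Or.inl hw, fun p q h => ?_, fun p q h => ?_, fun i => ?_⟩, hdist⟩
  · exact apart_of_le_min (hdist p q ▸ (edge h).1 rfl)
  · exact close_of_min_le (hdist p q ▸ by linarith [(edge h).2 rfl])
  · refine (triangle_dist_of_isCircularColoring hr hφ i).imp (fun h => ?_)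
      (Or.imp (fun h => ?_) (fun h => ?_))
    · exact apart_of_le_min ((hdist _ _).symm ▸ h)
    · exact close_of_min_le ((hdist _ _).symm ▸ h)
    · exact close_of_min_le ((hdist _ _).symm ▸ h)

theorem le_dist_of_isCircularColoring_filledWenger {τ : Fin 4 → MiniVertex → ℤˣ}
    (hτ : IsAdmissibleSwitching τ) {r : ℝ} (hr : 4 ≤ r) (hr' : r < 14 / 3)
    {φ : WengerVertex ⊕ Fin 4 × Fin 3 → AddCircle r}
    (hφ : (filledWenger τ).IsCircularColoring r φ) :
    4 / 9 ≤ dist (φ (Sum.inl .u)) (φ (Sum.inl .v)) := by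
  obtain ⟨ψ, hψ, hψφ⟩ := exists_isCircularColoring_filledWenger hτ isAdmissibleSwitching_z hφ
  obtain ⟨l, hl, hdist⟩ := exists_isWengerLift hr hψ
  rw [← hψφ, ← hψφ, hdist]
  exact (hl.apart_u_v hr hr').le_min_abs (by norm_num)

/-- Stretching the circle turns colorings into colorings. -/
theorem SignedGraph.IsCircularColoring.exists_of_le {V E : Type*} {G : SignedGraph V E} {r R : ℝ}
    {f : V → AddCircle r} (h : G.IsCircularColoring r f) (hr : 0 < r) (hR : r ≤ R) :
    ∃ g : V → AddCircle R, G.IsCircularColoring R g := by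
  rcases isEmpty_or_nonempty V with hV | ⟨⟨w⟩⟩
  · exact ⟨fun x => hV.elim x, fun _ x => hV.elim x⟩
  have hR0 : 0 < R := hr.trans_le hR
  obtain ⟨l, hl, -, hdist⟩ := exists_lift hr f w
  have h1 : 1 ≤ R / r := (one_le_div hr).2 hR
  have h0 : 0 ≤ R / r := zero_le_one.trans h1
  have hRr : R = R / r * r := (div_mul_cancel₀ R hr.ne').symm
  have hg (x y : V) : dist ((R / r * l x : ℝ) : AddCircle R) ((R / r * l y : ℝ) : AddCircle R) =
      R / r * dist (f x) (f y) := by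
    have habs : |R / r * l x - R / r * l y| = R / r * |l x - l y| := by
      rw [← mul_sub, abs_mul, abs_of_nonneg h0]
    rw [dist_eq_norm, ← AddCircle.coe_sub, AddCircle.norm_coe_eq_min hR0, habs, hdist,
      mul_min_of_nonneg _ _ h0, mul_sub, ← hRr]
    rw [habs]
    conv_rhs => rw [hRr]
    refine mul_le_mul_of_nonneg_left (abs_le.2 ⟨?_, ?_⟩) h0 <;>
      linarith [(hl x).1, (hl x).2, (hl y).1, (hl y).2]
  refine ⟨fun x => ((R / r * l x : ℝ) : AddCircle R), fun e x y he => ⟨fun hs => ?_, fun hs => ?_⟩⟩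
  · rw [hg]
    exact one_le_mul_of_one_le_of_one_le h1 ((h e x y he).1 hs)
  · have h2 := (h e x y he).2 hs
    rw [AddCircle.dist_add_coe_half hr] at h2
    rw [AddCircle.dist_add_coe_half hR0, hg]
    have h3 := one_le_mul_of_one_le_of_one_le h1 h2
    have h4 : R / r * (r / 2 - dist (f x) (f y)) = R / 2 - R / r * dist (f x) (f y) := by
      rw [mul_sub, ← mul_div_assoc, ← hRr]
    linarith

/-- As `r / 2 - 1 < r / 3`, the four points would lie on an arc of length at most
`r / 2 - 1 < 4 / 3`, which has no room for three gaps of length at least `4 / 9`. -/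
theorem not_forall_dist_of_four {r : ℝ} (hr : 4 ≤ r) (hr' : r < 14 / 3) (c : Fin 4 → AddCircle r) :
    ¬ ∀ p q, p ≠ q → 4 / 9 ≤ dist (c p) (c q) ∧ dist (c p) (c q) ≤ r / 2 - 1 := by
  intro h
  have hr0 : 0 < r := by linarith
  have hl (p : Fin 4) : ∃ t : ℝ, (t : AddCircle r) = c p - c 0 ∧ |t| ≤ r / 2 - 1 := by
    obtain ⟨t, ht, hn⟩ := AddCircle.exists_coe_eq_and_abs_eq_norm (c p - c 0)
    refine ⟨t, ht, ?_⟩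
    rw [hn, ← dist_eq_norm]
    by_cases hp : p = 0
    · rw [hp, dist_self]
      linarith
    · exact (h p 0 hp).2
  choose t ht hle using hl
  have key (p q : Fin 4) (hpq : p ≠ q) : 4 / 9 ≤ |t p - t q| ∧ |t p - t q| ≤ r / 2 - 1 := by
    have hp := abs_le.1 (hle p)
    have hq := abs_le.1 (hle q)
    have h1 : |t p - t q| ≤ r - 2 := by
      rw [abs_le]
      constructor <;> linarith
    have h2 : dist (c p) (c q) = min |t p - t q| (r - |t p - t q|) := by
      rw [← AddCircle.norm_coe_eq_min hr0 (by linarith), AddCircle.coe_sub, ht, ht,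
        sub_sub_sub_cancel_right, dist_eq_norm]
    have h3 := h p q hpq
    rw [h2, le_min_iff, min_le_iff] at h3
    exact ⟨h3.1.1, h3.2.resolve_right (by linarith)⟩
  have h01 := key 0 1 (by decide)
  have h02 := key 0 2 (by decide)
  have h03 := key 0 3 (by decide)
  have h12 := key 1 2 (by decide)
  have h13 := key 1 3 (by decide)
  have h23 := key 2 3 (by decide)
  rw [le_abs, abs_le] at h01 h02 h03 h12 h13 h23
  obtain ⟨h01, l01, u01⟩ := h01
  obtain ⟨h02, l02, u02⟩ := h02
  obtain ⟨h03, l03, u03⟩ := h03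
  obtain ⟨h12, l12, u12⟩ := h12
  obtain ⟨h13, l13, u13⟩ := h13
  obtain ⟨h23, l23, u23⟩ := h23
  rcases h01 with h01 | h01 <;> rcases h02 with h02 | h02 <;> rcases h03 with h03 | h03 <;>
    rcases h12 with h12 | h12 <;> rcases h13 with h13 | h13 <;> rcases h23 with h23 | h23 <;>
    linarith

theorem not_isCircularColoring_omegaGraph {τ : Fin 4 → MiniVertex → ℤˣ}
    (hτ : IsAdmissibleSwitching τ) (o : EdgeOrientation (⊤ : SimpleGraph (Fin 4))) {r : ℝ}
    (hr : 4 ≤ r) (hr' : r < 14 / 3) (f) : ¬ (omegaGraph τ o).IsCircularColoring r f := by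
  intro hf
  refine not_forall_dist_of_four hr hr' (fun k => f (Sum.inl k)) fun p q hpq => ?_
  let e : (⊤ : SimpleGraph (Fin 4)).edgeSet := ⟨s(p, q), hpq⟩
  have key : 4 / 9 ≤ dist (f (Sum.inl (o.toProd e).1)) (f (Sum.inl (o.toProd e).2)) ∧
      dist (f (Sum.inl (o.toProd e).1)) (f (Sum.inl (o.toProd e).2)) ≤ r / 2 - 1 := by
    have he := SignedIndicator.isCircularColoring_comp_place hf e
    obtain ⟨h1, -, h2⟩ := SignedGraph.isCircularColoring_addEdge_iff.1 he
    have h3 := le_dist_of_isCircularColoring_filledWenger hτ hr hr' h1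
    replace h2 := h2 rfl
    rw [AddCircle.dist_add_coe_half (by linarith)] at h2
    have hu : (wengerIndicator τ).place ⊤ o e (Sum.inl .u) = Sum.inl (o.toProd e).1 :=
      dif_pos rfl
    have hv : (wengerIndicator τ).place ⊤ o e (Sum.inl .v) = Sum.inl (o.toProd e).2 :=
      (dif_neg (wengerIndicator τ).u_ne_v.symm).trans (dif_pos rfl)
    rw [hu, hv] at h2 h3
    exact ⟨h3, by linarith⟩
  rcases Sym2.eq_iff.1 (o.mk_toProd e) with ⟨h1, h2⟩ | ⟨h1, h2⟩
  · rwa [h1, h2] at key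
  · rwa [h1, h2, dist_comm] at key

theorem circularChromaticNumber_omegaGraph {τ : Fin 4 → MiniVertex → ℤˣ}
    (hτ : IsAdmissibleSwitching τ) (o : EdgeOrientation (⊤ : SimpleGraph (Fin 4))) :
    (omegaGraph τ o).circularChromaticNumber = 14 / 3 := by
  refine IsLeast.csInf_eq ⟨⟨by norm_num, exists_isCircularColoring_omegaGraph hτ o⟩, ?_⟩
  rintro r ⟨hr1, f, hf⟩
  by_contra! hlt
  rcases le_total 4 r with hr | hr
  · exact not_isCircularColoring_omegaGraph hτ o hr hlt f hf
  · obtain ⟨g, hg⟩ := hf.exists_of_le (by linarith) hr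
    exact not_isCircularColoring_omegaGraph hτ o le_rfl (by norm_num) g hg

theorem nonempty_edgeOrientation {V : Type*} (G : SimpleGraph V) : Nonempty (EdgeOrientation G) :=
  ⟨⟨fun e => Quot.out (e : Sym2 V), fun e => Quot.out_eq (e : Sym2 V)⟩⟩

theorem mainTheorem1 :
    (∀ τ : Fin 4 → MiniVertex → ℤˣ, IsAdmissibleSwitching τ →
      (∀ ε : ℝ, 0 < ε → ε ≤ 2 / 3 →
        ∀ φ : WengerVertex ⊕ Fin 4 × Fin 3 → AddCircle (14 / 3 - ε),
          (filledWenger τ).IsCircularColoring (14 / 3 - ε) φ →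
            4 / 9 ≤ dist (φ (Sum.inl .u)) (φ (Sum.inl .v))) ∧
      (∀ o : EdgeOrientation (⊤ : SimpleGraph (Fin 4)),
        (omegaGraph τ o).IsPlanar ∧ (omegaGraph τ o).IsSimple ∧
          (omegaGraph τ o).circularChromaticNumber = 14 / 3)) ∧
    (((4 + 2 / 3 : ℝ)) : EReal) ≤ chiSignedPlanarSimple := by
  refine ⟨fun τ hτ => ⟨fun ε h0 h1 φ hφ => ?_, fun o => ?_⟩, ?_⟩
  · exact le_dist_of_isCircularColoring_filledWenger hτ (by linarith) (by linarith) hφ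
  · obtain ⟨pos, tail, head, h⟩ := isStraightLineDrawing_omegaGraph τ o
    exact ⟨h.isPlanar, h.isSimple, circularChromaticNumber_omegaGraph hτ o⟩
  · obtain ⟨o⟩ := nonempty_edgeOrientation (⊤ : SimpleGraph (Fin 4))
    obtain ⟨pos, tail, head, h⟩ := isStraightLineDrawing_omegaGraph (fun _ => switchZ) o
    refine le_sSup ⟨_, _, inferInstance, inferInstance, omegaGraph (fun _ => switchZ) o,
      h.isPlanar, h.isSimple, ?_⟩
    rw [circularChromaticNumber_omegaGraph (τ := fun _ => switchZ) isAdmissibleSwitching_z o]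
    norm_num
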